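/- Let $p$ be a prime, let $\mathbb C_p$ be the completion of an algebraic closure of $\mathbb Q_p$, with $|p|=1/p$, and let $d\ge 2$, $\mu\ge 0$, $n$, $N\ge\mu+1$ be integers with $n+1=d(\mu+1)$. Let ${\bf a}_1,\dots,{\bf a}_N\in\mathbb N^{n+1}$ be vectors whose coordinates each sum to $d$, and suppose that $\sum_{j=1}^{\mu+1}{\bf a}_j=(1,\dots,1)$. Put ${\bf a}_j^+=({\bf a}_j,1)\in\mathbb Z^{n+2}$. Let $\gamma_0\in\mathbb C_p$ be a zero of $\sum_{i\ge0}t^{p^i}/p^i$ with $|\gamma_0|=p^{-1/(p-1)}$, and set $\gamma_j=\sum_{i=0}^j\gamma_0^{p^i}/p^i$, $$\theta(t)=\exp\Big(\sum_{i\ge0}\frac{(\gamma_0t)^{p^i}}{p^i}\Big),\qquad \hat\theta_1(t)=\prod_{j\ge1}\exp(\gamma_jt^{p^j})=\exp\Big(\sum_{j\ge 1}\gamma_jt^{p^j}\Big),\qquad \zeta(t)=\sum_{l\ge0}(-1)^l\,l!\,t^{-l-1}.$$ For variables $\Lambda=(\Lambda_1,\dots,\Lambda_N)$ and $x=(x_0,\dots,x_{n+1})$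 put $\theta(\Lambda,x)=\prod_{j=1}^N\theta(\Lambda_jx^{{\bf a}_j^+})$ and $\hat\theta_1(\Lambda,x)=\prod_{j=1}^N\hat\theta_1(\Lambda_jx^{{\bf a}_j^+})$. Let $\delta_-$ be the operator on formal Laurent series that keeps exactly the terms in which all exponents of $x_0,\dots,x_{n+1}$ are negative, and define $$F(\Lambda,x)=\delta_-\Big(\prod_{j=1}^{\mu+1}\zeta(\gamma_0\Lambda_jx^{{\bf a}_j^+})\prod_{j=\mu+2}^N\exp(\gamma_0\Lambda_jx^{{\bf a}_j^+})\Big),\qquad G(\Lambda,x)=\delta_-\big(F(\Lambda,x)\,\hat\theta_1(\Lambda,x)\big).$$ Let $M_-$ be the set of elements with all coordinates negative in the subgroup of $\mathbb Z^{n+2}$ generated by the ${\bf a}_j^+$; let $E$ be the set of $\nu\in\mathbb Z^N$ with $\nu_j\le0$ for $j\le\mu+1$ and $\nu_j\ge0$ for $j\ge\mu+2$; and let $\mathcal D$ be the set of $\Lambda\in\mathbb C_p^N$ with $|\Lambda_j|>1$ for $j\le\mu+1$ and $|\Lambda_j|<1$ for $j\ge\mu+2$. For $u\in M_-$ let $R_u$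 be the space of series $\sum c_\nu\Lambda^\nu$ over the $\nu\in E$ with $\sum_j\nu_j{\bf a}_j^+=u$, with bounded coefficients $c_\nu\in\mathbb C_p$, normed by $|\xi|=\sup_{\Lambda\in\mathcal D}|\xi(\Lambda)|$. Let $S$ be the space of formal series $\sum_{u\in M_-}\xi_u(\Lambda)\gamma_0^{u_{n+1}}x^u$ with $\xi_u\in R_u$ and $\{|\xi_u|\}_u$ bounded, and for $\xi\in S$ let $$\alpha^*(\xi(\Lambda,x))=\delta_-\big(\theta(\Lambda,x)\,\xi(\Lambda^p,x^p)\big),$$ where $\Lambda^p=(\Lambda_1^p,\dots,\Lambda_N^p)$ and $x^p=(x_0^p,\dots,x_{n+1}^p)$. Then all the sums over pairs of monomials that define the coefficients of $G(\Lambda,x)$ and of $\alpha^*(G(\Lambda,x))$ converge unconditionally in $\mathbb C_p$, $G(\Lambda,x)$ is a nonzero element of $S$, and $$\alpha^*\big(G(\Lambda,x)\big)=p^{\mu+1}\,G(\Lambda,x).$$ -/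

import Mathlib

noncomputable section

namespace GenCY

variable {p : ℕ} [Fact p.Prime] {n N : ℕ}

/-! ### One-variable series -/

/-- The power series `∑_{i ≥ 0} c_i t^{p^i}` (if `p ^ i = m` then `i ≤ m`, so the inner sum picks
up exactly the index `i` with `p ^ i = m`, if there is one). -/
def lacunary (p : ℕ) [Fact p.Prime] (c : ℕ → ℂ_[p]) : PowerSeries ℂ_[p] :=
  PowerSeries.mk fun m => ∑ i ∈ Finset.range (m + 1), if m = p ^ i then c i else 0

/-- The Artin-Hasse series `AH(t) = exp (∑_{i ≥ 0} t^{p^i} / p^i)`. -/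
def artinHasse (p : ℕ) [Fact p.Prime] : PowerSeries ℂ_[p] :=
  (PowerSeries.exp ℂ_[p]).subst (lacunary p fun i => 1 / (p : ℂ_[p]) ^ i)

/-- `θ(t) = AH(γ₀ t)`. -/
def theta (γ₀ : ℂ_[p]) : PowerSeries ℂ_[p] :=
  PowerSeries.rescale γ₀ (artinHasse p)

/-- `γ_j = ∑_{i=0}^{j} γ₀^{p^i} / p^i`. -/
def gam (γ₀ : ℂ_[p]) (j : ℕ) : ℂ_[p] :=
  ∑ i ∈ Finset.range (j + 1), γ₀ ^ (p ^ i) / (p : ℂ_[p]) ^ i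

/-- `θ̂₁(t) = ∏_{j ≥ 1} exp (γ_j t^{p^j}) = exp (∑_{j ≥ 1} γ_j t^{p^j})`. -/
def thetaHatOne (γ₀ : ℂ_[p]) : PowerSeries ℂ_[p] :=
  (PowerSeries.exp ℂ_[p]).subst (lacunary p fun j => if j = 0 then 0 else gam γ₀ j)

/-- The coefficient family, indexed by `ℤ`, of a power series. -/
def coeffZ (f : PowerSeries ℂ_[p]) (k : ℤ) : ℂ_[p] :=
  if 0 ≤ k then PowerSeries.coeff k.toNat f else 0

/-- The coefficient of `t^k` in `ζ(t) = ∑_{l ≥ 0} (-1)^l l! t^{-l-1}`. -/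
def zetaCoeff (p : ℕ) [Fact p.Prime] (k : ℤ) : ℂ_[p] :=
  if k < 0 then (-1) ^ (-k - 1).toNat * (Nat.factorial (-k - 1).toNat : ℂ_[p]) else 0

/-! ### Exponents -/

/-- The vector `a_j⁺ = (a_j, 1) ∈ ℤ^{n+2}`. -/
def aPlus (a : Fin N → Fin (n + 1) → ℕ) (j : Fin N) : Fin (n + 2) → ℤ :=
  Fin.snoc (α := fun _ => ℤ) (fun i => (a j i : ℤ)) 1

/-- The degree `∑_j ν_j a_j⁺` of the monomial `Λ^ν`. -/
def deg (a : Fin N → Fin (n + 1) → ℕ) (ν : Fin N → ℤ) : Fin (n + 2) → ℤ :=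
  ∑ j, ν j • aPlus a j

/-- The set `E ⊆ ℤ^N`: exponents that are `≤ 0` in the first `μ + 1` places and `≥ 0` in the
others. -/
def expE (N μ : ℕ) : Set (Fin N → ℤ) :=
  {ν | ∀ j : Fin N, ((j : ℕ) < μ + 1 → ν j ≤ 0) ∧ (μ + 1 ≤ (j : ℕ) → 0 ≤ ν j)}

/-- `M_-`: the elements of the group `M` generated by the `a_j⁺` all of whose coordinates are
negative. -/
def Mminus (a : Fin N → Fin (n + 1) → ℕ) : Set (Fin (n + 2) → ℤ) :=
  {u | u ∈ AddSubgroup.closure (Set.range (aPlus a)) ∧ ∀ i, u i < 0}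

/-! ### Formal Laurent series in `x` and `Λ` -/

/-- Formal Laurent series with coefficients in `ℂ_p`: the value at `(u, ν)` is the coefficient of
`x^u Λ^ν`. -/
abbrev Series (p : ℕ) [Fact p.Prime] (n N : ℕ) : Type :=
  (Fin (n + 2) → ℤ) × (Fin N → ℤ) → ℂ_[p]

/-- The truncation operator `δ_-`, keeping the terms all of whose `x`-exponents are negative. -/
def deltaMinus (f : Series p n N) : Series p n N :=
  fun m => if ∀ i, m.1 i < 0 then f m else 0

/-- The family of terms whose sum is the coefficient of the monomial `m` in the product `f g`. -/
def mulTerm (f g : Series p n N) (m q : (Fin (n + 2) → ℤ) × (Fin N → ℤ)) : ℂ_[p] :=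
  f q * g (m - q)

/-- The product `f g` of formal series, the coefficients being sums in `ℂ_p`. -/
def mulSeries (f g : Series p n N) : Series p n N :=
  fun m => ∑' q, mulTerm f g m q

/-- All the coefficients that enter `δ_-(f g)` are given by (unconditionally) convergent sums. -/
def DeltaMulConverges (f g : Series p n N) : Prop :=
  ∀ m : (Fin (n + 2) → ℤ) × (Fin N → ℤ), (∀ i, m.1 i < 0) → Summable (mulTerm f g m)

/-- The product `∏_j f_j(Λ_j x^{a_j⁺})` of one-variable series `f_j(t) = ∑_{k ∈ ℤ} c_j(k) t^k`.
The variables `Λ_j` being distinct, the monomial `∏_j (Λ_j x^{a_j⁺})^{ν_j} = x^{deg ν} Λ^ν` arises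
in exactly one way. -/
def prodSubst (a : Fin N → Fin (n + 1) → ℕ) (c : Fin N → ℤ → ℂ_[p]) : Series p n N :=
  fun m => if m.1 = deg a m.2 then ∏ j, c j (m.2 j) else 0

/-- `f(Λ, x) ↦ f(Λ^p, x^p)`. -/
def powSubst (f : Series p n N) : Series p n N :=
  fun m => if (∀ i, (p : ℤ) ∣ m.1 i) ∧ (∀ j, (p : ℤ) ∣ m.2 j) then
    f (fun i => m.1 i / (p : ℤ), fun j => m.2 j / (p : ℤ)) else 0

/-- `θ(Λ, x) = ∏_{j=1}^N θ(Λ_j x^{a_j⁺})`. -/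
def thetaSeries (a : Fin N → Fin (n + 1) → ℕ) (γ₀ : ℂ_[p]) : Series p n N :=
  prodSubst a fun _ => coeffZ (theta γ₀)

/-- `θ̂₁(Λ, x) = ∏_{j=1}^N θ̂₁(Λ_j x^{a_j⁺})`. -/
def thetaHatOneSeries (a : Fin N → Fin (n + 1) → ℕ) (γ₀ : ℂ_[p]) : Series p n N :=
  prodSubst a fun _ => coeffZ (thetaHatOne γ₀)

/-- `F(Λ, x) = δ_-(∏_{j ≤ μ+1} ζ(γ₀ Λ_j x^{a_j⁺}) ∏_{j > μ+1} exp(γ₀ Λ_j x^{a_j⁺}))`. -/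
def FSeries (a : Fin N → Fin (n + 1) → ℕ) (μ : ℕ) (γ₀ : ℂ_[p]) : Series p n N :=
  deltaMinus (prodSubst a fun j k =>
    if (j : ℕ) < μ + 1 then zetaCoeff p k * γ₀ ^ k
    else coeffZ (PowerSeries.rescale γ₀ (PowerSeries.exp ℂ_[p])) k)

/-- `G(Λ, x) = δ_-(F(Λ, x) θ̂₁(Λ, x))`. -/
def GSeries (a : Fin N → Fin (n + 1) → ℕ) (μ : ℕ) (γ₀ : ℂ_[p]) : Series p n N :=
  deltaMinus (mulSeries (FSeries a μ γ₀) (thetaHatOneSeries a γ₀))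

/-- `α*(ξ(Λ, x)) = δ_-(θ(Λ, x) ξ(Λ^p, x^p))`. -/
def alphaStar (a : Fin N → Fin (n + 1) → ℕ) (γ₀ : ℂ_[p]) (ξ : Series p n N) : Series p n N :=
  deltaMinus (mulSeries (thetaSeries a γ₀) (powSubst ξ))

/-! ### The spaces `R_u` and `S` -/

/-- The polydisk `𝒟`: `|Λ_j| > 1` for the first `μ + 1` variables, `|Λ_j| < 1` for the others. -/
def domD (p : ℕ) [Fact p.Prime] (N μ : ℕ) : Set (Fin N → ℂ_[p]) :=
  {z | ∀ j : Fin N, ((j : ℕ) < μ + 1 → 1 < ‖z j‖) ∧ (μ + 1 ≤ (j : ℕ) → ‖z j‖ < 1)}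

/-- `R_u`: series `∑ c_ν Λ^ν` with bounded coefficients over the `ν ∈ E` with
`∑_j ν_j a_j⁺ = u`. -/
def spaceR (a : Fin N → Fin (n + 1) → ℕ) (μ : ℕ) (u : Fin (n + 2) → ℤ) :
    Set ((Fin N → ℤ) → ℂ_[p]) :=
  {c | (∀ ν, c ν ≠ 0 → ν ∈ expE N μ ∧ deg a ν = u) ∧ ∃ B : ℝ, ∀ ν, ‖c ν‖ ≤ B}

/-- The value at `z` of the series `∑_ν c_ν Λ^ν`; it converges for `c ∈ R_u` and `z ∈ 𝒟`. -/
def evalR (c : (Fin N → ℤ) → ℂ_[p]) (z : Fin N → ℂ_[p]) : ℂ_[p] :=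
  ∑' ν : Fin N → ℤ, c ν * ∏ j, z j ^ ν j

/-- The coefficient `ξ_u(Λ)` in `ξ(Λ, x) = ∑_u ξ_u(Λ) γ₀^{u_{n+1}} x^u`. -/
def coeffX (γ₀ : ℂ_[p]) (ξ : Series p n N) (u : Fin (n + 2) → ℤ) : (Fin N → ℤ) → ℂ_[p] :=
  fun ν => (γ₀ ^ u (Fin.last (n + 1)))⁻¹ * ξ (u, ν)

/-- `S`: the series `ξ(Λ, x) = ∑_{u ∈ M_-} ξ_u(Λ) γ₀^{u_{n+1}} x^u` with `ξ_u ∈ R_u` and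
`|ξ_u| = sup_{Λ ∈ 𝒟} |ξ_u(Λ)|` bounded independently of `u`. -/
def spaceS (a : Fin N → Fin (n + 1) → ℕ) (μ : ℕ) (γ₀ : ℂ_[p]) : Set (Series p n N) :=
  {ξ | (∀ u ν, ξ (u, ν) ≠ 0 → u ∈ Mminus a) ∧
    (∀ u ∈ Mminus a, coeffX γ₀ ξ u ∈ spaceR a μ u) ∧
    ∃ B : ℝ, ∀ u ∈ Mminus a, ∀ z ∈ domD p N μ, ‖evalR (coeffX γ₀ ξ u) z‖ ≤ B}

end GenCY

end

noncomputable section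

namespace GenCY

open PowerSeries Filter Topology

section Formal

variable {K : Type*} [Field K]

/-- The series `∑_i c_i X^{p^i}` over an arbitrary field. -/
def lacSeries (p : ℕ) (c : ℕ → K) : K⟦X⟧ :=
  PowerSeries.mk fun m => ∑ i ∈ Finset.range (m + 1), if m = p ^ i then c i else 0

/-- The series `exp (∑_i c_i X^{p^i})`. -/
def expLac [Algebra ℚ K] (p : ℕ) (c : ℕ → K) : K⟦X⟧ :=
  (PowerSeries.exp K).subst (lacSeries p c)

variable (p : ℕ)

theorem coeff_lacSeries_of_ne (c : ℕ → K) {m : ℕ} (h : ∀ i, m ≠ p ^ i) :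
    coeff m (lacSeries p c) = 0 := by
  rw [lacSeries, coeff_mk]
  exact Finset.sum_eq_zero fun i _ => if_neg (h i)

variable [hp : Fact p.Prime]

theorem coeff_lacSeries_pow (c : ℕ → K) (i : ℕ) : coeff (p ^ i) (lacSeries p c) = c i := by
  rw [lacSeries, coeff_mk]
  rw [Finset.sum_eq_single i]
  · simp
  · exact fun l _ hl => if_neg fun hh => hl (Nat.pow_right_injective hp.1.two_le hh).symm
  · exact fun hh => absurd (Finset.mem_range.2
      (Nat.lt_succ_of_lt (Nat.lt_pow_self hp.1.one_lt))) hh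

theorem lacSeries_ext {f : K⟦X⟧} (c : ℕ → K) (h1 : ∀ i, coeff (p ^ i) f = c i)
    (h2 : ∀ m, (∀ i, m ≠ p ^ i) → coeff m f = 0) : f = lacSeries p c := by
  ext m
  by_cases h : ∃ i, m = p ^ i
  · obtain ⟨i, rfl⟩ := h
    rw [h1, coeff_lacSeries_pow]
  · push Not at h
    rw [h2 m h, coeff_lacSeries_of_ne p c h]

theorem constantCoeff_lacSeries (c : ℕ → K) : constantCoeff (lacSeries p c) = 0 := by
  rw [← coeff_zero_eq_constantCoeff_apply]
  exact coeff_lacSeries_of_ne p c fun i => (pow_pos hp.1.pos i).ne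

theorem hasSubst_lacSeries (c : ℕ → K) : HasSubst (lacSeries p c) :=
  HasSubst.of_constantCoeff_zero' (constantCoeff_lacSeries p c)

theorem lacSeries_add (c c' : ℕ → K) :
    lacSeries p (c + c') = lacSeries p c + lacSeries p c' := by
  symm
  apply lacSeries_ext
  · intro i
    simp [coeff_lacSeries_pow]
  · intro m h
    simp [coeff_lacSeries_of_ne p _ h]

theorem expand_lacSeries (c : ℕ → K) :
    expand p hp.1.ne_zero (lacSeries p c) =
      lacSeries p fun i => if i = 0 then 0 else c (i - 1) := by
  apply lacSeries_ext
  · intro i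
    cases i with
    | zero =>
      rw [if_pos rfl, coeff_expand_of_not_dvd]
      simpa using hp.1.one_lt.ne'
    | succ i => simp [pow_succ', coeff_expand_mul, coeff_lacSeries_pow]
  · intro m h
    by_cases hm : p ∣ m
    · obtain ⟨k, rfl⟩ := hm
      rw [coeff_expand_mul, coeff_lacSeries_of_ne]
      rintro i rfl
      exact h (i + 1) (pow_succ' p i).symm
    · exact coeff_expand_of_not_dvd _ _ _ hm

theorem rescale_lacSeries (γ : K) (c : ℕ → K) :
    rescale γ (lacSeries p c) = lacSeries p fun i => c i * γ ^ p ^ i := by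
  apply lacSeries_ext
  · intro i
    rw [coeff_rescale, coeff_lacSeries_pow, mul_comm]
  · intro m h
    rw [coeff_rescale, coeff_lacSeries_of_ne p _ h, mul_zero]

theorem map_lacSeries {L : Type*} [Field L] (φ : K →+* L) (c : ℕ → K) :
    PowerSeries.map φ (lacSeries p c) = lacSeries p fun i => φ (c i) := by
  apply lacSeries_ext
  · intro i
    rw [coeff_map, coeff_lacSeries_pow]
  · intro m h
    rw [coeff_map, coeff_lacSeries_of_ne p _ h, map_zero]

theorem lacSeries_single (γ : K) : lacSeries p (Pi.single 0 γ) = γ • X := by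
  symm
  apply lacSeries_ext
  · intro i
    cases i with
    | zero => simp
    | succ i => 
      have : p ^ (i + 1) ≠ 1 := (Nat.one_lt_pow (Nat.succ_ne_zero i) hp.1.one_lt).ne'
      rw [map_smul, coeff_X, if_neg this]
      simp
  · intro m h
    have : m ≠ 1 := by simpa using h 0
    simp [coeff_X, this]

theorem ode_unique [CharZero K] {P f g : K⟦X⟧} (hf : d⁄dX K f = P * f) (hg : d⁄dX K g = P * g)
    (h0 : constantCoeff f = constantCoeff g) : f = g := by
  ext m
  induction m using Nat.strong_induction_on with
  | _ m ih =>
    cases m with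
    | zero => simpa using h0
    | succ m =>
      have h1 : coeff (m + 1) f * ((m : K) + 1) = coeff (m + 1) g * ((m : K) + 1) := by
        rw [← coeff_derivative, ← coeff_derivative, hf, hg, coeff_mul, coeff_mul]
        refine Finset.sum_congr rfl fun q hq => ?_
        rw [ih q.2 (by have := Finset.HasAntidiagonal.mem_antidiagonal.1 hq; omega)]
      exact mul_right_cancel₀ (Nat.cast_add_one_ne_zero m) h1

variable [Algebra ℚ K]

theorem constantCoeff_expLac (c : ℕ → K) : constantCoeff (expLac p c) = 1 := by
  rw [expLac, ← coeff_zero_eq_constantCoeff_apply, coeff_subst' (hasSubst_lacSeries p c),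
    finsum_eq_single _ 0]
  · simp
  · intro n hn
    simp [constantCoeff_lacSeries, hn]

theorem coeff_zero_expLac (c : ℕ → K) : coeff 0 (expLac p c) = 1 := by
  rw [coeff_zero_eq_constantCoeff_apply, constantCoeff_expLac]

theorem derivative_expLac (c : ℕ → K) :
    d⁄dX K (expLac p c) = d⁄dX K (lacSeries p c) * expLac p c := by
  rw [expLac, derivative_subst (hasSubst_lacSeries p c), derivative_exp, mul_comm]

theorem expLac_add [CharZero K] (c c' : ℕ → K) :
    expLac p (c + c') = expLac p c * expLac p c' := by
  refine ode_unique (derivative_expLac p (c + c')) ?_ ?_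
  · rw [Derivation.leibniz, derivative_expLac, derivative_expLac, lacSeries_add, map_add]
    simp only [smul_eq_mul]
    ring
  · simp [constantCoeff_expLac]

theorem expLac_zero [CharZero K] : expLac p (0 : ℕ → K) = 1 := by
  have h := expLac_add p (0 : ℕ → K) 0
  rw [add_zero] at h
  have h0 : expLac p (0 : ℕ → K) ≠ 0 := by
    intro hh
    have := constantCoeff_expLac p (0 : ℕ → K)
    rw [hh] at this
    simp at this
  exact (mul_eq_left₀ h0).1 h.symm

theorem expLac_mul_neg [CharZero K] (c : ℕ → K) : expLac p c * expLac p (-c) = 1 := by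
  rw [← expLac_add, add_neg_cancel, expLac_zero]

theorem expand_expLac (c : ℕ → K) :
    expand p hp.1.ne_zero (expLac p c) = expLac p fun i => if i = 0 then 0 else c (i - 1) := by
  rw [expLac, expLac, ← expand_lacSeries]
  exact expand_subst p hp.1.ne_zero (hasSubst_lacSeries p c) _

theorem rescale_expLac (γ : K) (c : ℕ → K) :
    rescale γ (expLac p c) = expLac p fun i => c i * γ ^ p ^ i := by
  rw [expLac, rescale_eq_subst, subst_comp_subst_apply (hasSubst_lacSeries p c)
    (HasSubst.smul_X' γ), ← rescale_eq_subst, rescale_lacSeries, expLac]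

theorem expLac_single (γ : K) : expLac p (Pi.single 0 γ) = rescale γ (PowerSeries.exp K) := by
  rw [rescale_eq_subst, expLac, lacSeries_single]

theorem map_expLac {L : Type*} [Field L] [Algebra ℚ L] [CharZero L] (φ : K →+* L) (c : ℕ → K) :
    PowerSeries.map φ (expLac p c) = expLac p fun i => φ (c i) := by
  refine ode_unique (P := d⁄dX L (lacSeries p fun i => φ (c i))) ?_ (derivative_expLac p _) ?_
  · have h (f : K⟦X⟧) : d⁄dX L (PowerSeries.map φ f) = PowerSeries.map φ (d⁄dX K f) := by
      ext m
      simp [coeff_derivative]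
    rw [h, derivative_expLac, map_mul, ← h, map_lacSeries]
  · rw [constantCoeff_expLac, ← coeff_zero_eq_constantCoeff_apply, coeff_map, coeff_zero_expLac,
      map_one]

end Formal

section Integrality

variable (p : ℕ) [hp : Fact p.Prime]

theorem expand_eq_pow_zmod (f : (ZMod p)⟦X⟧) : expand p hp.1.ne_zero f = f ^ p := by
  have h := MvPowerSeries.map_frobenius_expand p hp.1.ne_zero (f := f)
  rw [ZMod.frobenius_zmod, MvPowerSeries.map_id] at h
  exact h

theorem dvd_coeff_pow_sub_expand (f : ℤ_[p]⟦X⟧) (m : ℕ) :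
    (p : ℤ_[p]) ∣ coeff m (f ^ p - expand p hp.1.ne_zero f) := by
  have h : PowerSeries.map (PadicInt.toZMod (p := p)) (f ^ p - expand p hp.1.ne_zero f) = 0 := by
    rw [map_sub, map_pow, map_expand, expand_eq_pow_zmod, sub_self]
  have h2 : PadicInt.toZMod (p := p) (coeff m (f ^ p - expand p hp.1.ne_zero f)) = 0 := by
    rw [← coeff_map, h, map_zero]
  rw [← RingHom.mem_ker, PadicInt.ker_toZMod, PadicInt.maximalIdeal_eq_span_p,
    Ideal.mem_span_singleton] at h2
  exact h2

theorem expLac_one_div_pow (K : Type*) [Field K] [Algebra ℚ K] [CharZero K] :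
    expLac p (fun i => 1 / (p : K) ^ i) ^ p =
      expand p hp.1.ne_zero (expLac p fun i => 1 / (p : K) ^ i) *
        rescale (p : K) (PowerSeries.exp K) := by
  have hpow (c : ℕ → K) (k : ℕ) : expLac p c ^ k = expLac p (k • c) := by
    induction k with
    | zero => rw [pow_zero, zero_smul, expLac_zero]
    | succ k ih => rw [pow_succ, ih, succ_nsmul, expLac_add]
  have hp0 : (p : K) ≠ 0 := Nat.cast_ne_zero.2 hp.1.ne_zero
  rw [hpow, expand_expLac, ← expLac_single p, ← expLac_add]
  congr 1
  funext i
  cases i with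
  | zero => simp
  | succ i =>
    simp only [Pi.smul_apply, Pi.add_apply, nsmul_eq_mul, Nat.succ_ne_zero, if_false,
      Nat.add_sub_cancel, Pi.single_apply, add_zero]
    field_simp
    exact (pow_succ' _ _).symm

theorem norm_natCast_pow_div_factorial_le (j : ℕ) (hj : j ≠ 0) :
    ‖(p : ℚ_[p]) ^ j / (j.factorial : ℚ_[p])‖ ≤ (p : ℝ)⁻¹ := by
  have h0 : (j.factorial : ℚ_[p]) ≠ 0 := Nat.cast_ne_zero.2 j.factorial_ne_zero
  have hlt : padicValNat p j.factorial < j := padicValNat_factorial_lt_of_ne_zero p hj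
  rw [norm_div, norm_pow, Padic.norm_p, Padic.norm_eq_zpow_neg_valuation h0,
    Padic.valuation_natCast, div_eq_mul_inv, zpow_neg, inv_inv, zpow_natCast]
  have hp1 : (1 : ℝ) ≤ p := by exact_mod_cast hp.1.one_lt.le
  have hp0 : (0 : ℝ) < p := by linarith
  rw [inv_pow, inv_mul_le_iff₀ (by positivity), ← div_eq_mul_inv, le_div_iff₀ hp0, ← pow_succ]
  exact pow_le_pow_right₀ hp1 (by omega)

theorem coeff_add_X_pow_mul_pow {R : Type*} [CommRing R] (G r : R⟦X⟧) (m k : ℕ) (hm : 0 < m)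
    (hG : constantCoeff G = 1) :
    coeff m ((G + X ^ m * r) ^ k) = coeff m (G ^ k) + k * constantCoeff r := by
  obtain ⟨z, hz⟩ := Polynomial.powAddExpansion G (X ^ m * r) k
  rw [hz, map_add, map_add]
  have h1 : (k : R⟦X⟧) * G ^ (k - 1) * (X ^ m * r) = X ^ m * ((k : R⟦X⟧) * G ^ (k - 1) * r) := by
    ring
  have h2 : z * (X ^ m * r) ^ 2 = X ^ (m + 1) * (X ^ (m - 1) * z * r ^ 2) := by
    have : (X : R⟦X⟧) ^ m * X ^ m = X ^ (m + 1) * X ^ (m - 1) := by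
      rw [← pow_add, ← pow_add]
      congr 1
      omega
    linear_combination z * r ^ 2 * this
  rw [h1, h2, coeff_X_pow_mul', coeff_X_pow_mul', if_pos le_rfl, if_neg (by omega)]
  simp [hG]

theorem norm_coeff_artinHasse_padic_le (m : ℕ) :
    ‖coeff m (expLac p fun i => 1 / (p : ℚ_[p]) ^ i)‖ ≤ 1 := by
  have key := expLac_one_div_pow p ℚ_[p]
  have hf0 := constantCoeff_expLac p fun i => 1 / (p : ℚ_[p]) ^ i
  generalize (expLac p fun i => 1 / (p : ℚ_[p]) ^ i) = f at *
  induction m using Nat.strong_induction_on with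
  | _ m ih =>
  rcases Nat.eq_zero_or_pos m with rfl | hm
  · simp [hf0]
  have hlift (i : ℕ) : ∃ x : ℤ_[p], (i < m → (x : ℚ_[p]) = coeff i f) ∧ (m ≤ i → x = 0) := by
    by_cases h : i < m
    · exact ⟨⟨coeff i f, ih i h⟩, fun _ => rfl, fun h' => absurd h (not_lt.2 h')⟩
    · exact ⟨0, fun h' => absurd h' h, fun _ => rfl⟩
  choose x hx hx0 using hlift
  let Gi : ℤ_[p]⟦X⟧ := PowerSeries.mk x
  let G : ℚ_[p]⟦X⟧ := PowerSeries.map PadicInt.Coe.ringHom Gi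
  have hG (i : ℕ) (hi : i < m) : coeff i G = coeff i f := by
    rw [coeff_map, coeff_mk, ← hx i hi]
    rfl
  have hG' (i : ℕ) (hi : m ≤ i) : coeff i G = 0 := by
    rw [coeff_map, coeff_mk, hx0 i hi, map_zero]
  let r : ℚ_[p]⟦X⟧ := PowerSeries.mk fun i => coeff (i + m) f
  have hfr : f = G + X ^ m * r := by
    ext i
    rw [map_add, coeff_X_pow_mul']
    split_ifs with h
    · rw [hG' i h, zero_add, coeff_mk, Nat.sub_add_cancel h]
    · rw [hG i (not_le.1 h), add_zero]
  have hr : constantCoeff r = coeff m f := by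
    rw [← coeff_zero_eq_constantCoeff_apply, coeff_mk, zero_add]
  have hG0 : constantCoeff G = 1 := by
    rw [← coeff_zero_eq_constantCoeff_apply, hG 0 hm, coeff_zero_eq_constantCoeff_apply, hf0]
  have e1 : coeff m (f ^ p) = coeff m (G ^ p) + p * coeff m f := by
    conv_lhs => rw [hfr]
    rw [coeff_add_X_pow_mul_pow G r m p hm hG0, hr]
  have hexp (i : ℕ) (hi : i ≤ m) :
      coeff i (expand p hp.1.ne_zero f) = coeff i (expand p hp.1.ne_zero G) := by
    by_cases hd : p ∣ i
    · obtain ⟨k, rfl⟩ := hd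
      rw [coeff_expand_mul, coeff_expand_mul, hG]
      rcases Nat.eq_zero_or_pos k with rfl | hk
      · exact hm
      · have := Nat.mul_le_mul_right k hp.1.two_le
        omega
    · rw [coeff_expand_of_not_dvd _ _ _ hd, coeff_expand_of_not_dvd _ _ _ hd]
  have hGn (i : ℕ) : ‖coeff i (expand p hp.1.ne_zero G)‖ ≤ 1 := by
    rw [← map_expand, coeff_map]
    exact PadicInt.norm_le_one _
  have e2 : ‖coeff m (f ^ p) - coeff m (expand p hp.1.ne_zero G)‖ ≤ (p : ℝ)⁻¹ := by
    have hmem : (m, 0) ∈ Finset.HasAntidiagonal.antidiagonal m := by simp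
    rw [key, coeff_mul, ← Finset.add_sum_erase _ _ hmem]
    have : coeff 0 (rescale (p : ℚ_[p]) (PowerSeries.exp ℚ_[p])) = 1 := by simp
    rw [this, mul_one, hexp m le_rfl, add_sub_cancel_left]
    refine IsUltrametricDist.norm_sum_le_of_forall_le_of_nonneg (by positivity) ?_
    rintro ⟨i, j⟩ hij
    rw [Finset.mem_erase, Finset.HasAntidiagonal.mem_antidiagonal] at hij
    obtain ⟨hne, hs⟩ := hij
    have hj : j ≠ 0 := by
      rintro rfl
      exact hne (by simpa using hs)
    dsimp only at hs ⊢
    rw [norm_mul, hexp i (by omega)]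
    have h2 : ‖coeff j (rescale (p : ℚ_[p]) (PowerSeries.exp ℚ_[p]))‖ ≤ (p : ℝ)⁻¹ := by
      have := norm_natCast_pow_div_factorial_le p j hj
      rw [coeff_rescale, coeff_exp]
      simpa [div_eq_mul_inv] using this
    exact (mul_le_mul (hGn i) h2 (norm_nonneg _) zero_le_one).trans (one_mul _).le
  have e3 : ‖coeff m (G ^ p) - coeff m (expand p hp.1.ne_zero G)‖ ≤ (p : ℝ)⁻¹ := by
    obtain ⟨c, hc⟩ := dvd_coeff_pow_sub_expand p Gi m
    have : coeff m (G ^ p) - coeff m (expand p hp.1.ne_zero G) = ((p * c : ℤ_[p]) : ℚ_[p]) := by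
      rw [← hc, ← map_sub, ← map_expand, ← map_pow, ← map_sub, coeff_map]
      rfl
    rw [this, PadicInt.coe_mul, norm_mul, PadicInt.coe_natCast, Padic.norm_p]
    exact mul_le_of_le_one_right (by positivity) (PadicInt.norm_le_one c)
  have e4 : ‖(p : ℚ_[p]) * coeff m f‖ ≤ (p : ℝ)⁻¹ := by
    have : (p : ℚ_[p]) * coeff m f = (coeff m (f ^ p) - coeff m (expand p hp.1.ne_zero G)) -
        (coeff m (G ^ p) - coeff m (expand p hp.1.ne_zero G)) := by
      rw [e1]
      ring
    rw [this, sub_eq_add_neg]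
    refine (IsUltrametricDist.norm_add_le_max _ _).trans (max_le e2 ?_)
    rwa [norm_neg]
  rw [norm_mul, Padic.norm_p] at e4
  have hpos : (0 : ℝ) < (p : ℝ)⁻¹ := inv_pos.2 (by exact_mod_cast hp.1.pos)
  exact le_of_mul_le_mul_left (by rwa [mul_one]) hpos

theorem norm_coeff_artinHasse_le (K : Type*) [NormedField K] [NormedAlgebra ℚ_[p] K] [Algebra ℚ K]
    [CharZero K] (m : ℕ) : ‖coeff m (expLac p fun i => 1 / (p : K) ^ i)‖ ≤ 1 := by
  have h := map_expLac p (algebraMap ℚ_[p] K) fun i => 1 / (p : ℚ_[p]) ^ i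
  simp only [map_div₀, map_one, map_pow, map_natCast] at h
  rw [← h, coeff_map, norm_algebraMap']
  exact norm_coeff_artinHasse_padic_le p m

end Integrality

section Ultrametric

variable {K : Type*} [NormedField K]

theorem norm_neg_one_pow_mul (m : ℕ) (x : K) : ‖(-1) ^ m * x‖ = ‖x‖ := by
  rw [norm_mul, norm_pow, norm_neg, norm_one, one_pow, one_mul]

theorem hasSum_antidiagonal {t : ℕ × ℕ → K} {s : K} (ht : HasSum t s) :
    HasSum (fun n => ∑ q ∈ Finset.HasAntidiagonal.antidiagonal n, t q) s := by
  have h := (Finset.HasAntidiagonal.sigmaAntidiagonalEquivProd (A := ℕ)).hasSum_iff.2 ht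
  refine h.sigma fun n => ?_
  have h2 := Finset.hasSum (Finset.HasAntidiagonal.antidiagonal n) t
  exact h2

theorem hasSum_of_hasSum_fiber {t : ℕ × ℕ → K} {s : K} (ht : HasSum t s) {g : ℕ → K}
    (hg : ∀ j, HasSum (fun i => t (i, j)) (g j)) : HasSum g s := by
  have h : HasSum (fun q : ℕ × ℕ => t q.swap) s := (Equiv.prodComm ℕ ℕ).hasSum_iff.2 ht
  exact h.prod_fiberwise hg

variable [IsUltrametricDist K]

theorem nonarchimedeanRing_of_ultrametric : NonarchimedeanRing K where
  is_nonarchimedean := NonarchimedeanAddGroup.is_nonarchimedean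

theorem norm_mul_natCast_le (x : K) (n : ℕ) : ‖x * (n : K)‖ ≤ ‖x‖ := by
  rw [norm_mul]
  exact mul_le_of_le_one_right (norm_nonneg _) (IsUltrametricDist.norm_natCast_le_one K n)

theorem norm_natCast_le_of_dvd {a b : ℕ} (h : a ∣ b) : ‖(b : K)‖ ≤ ‖(a : K)‖ := by
  obtain ⟨c, rfl⟩ := h
  rw [Nat.cast_mul]
  exact norm_mul_natCast_le _ _

variable [CompleteSpace K]

theorem summable_of_tendsto_nat {f : ℕ → K} (hf : Tendsto f atTop (𝓝 0)) : Summable f := by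
  apply NonarchimedeanAddGroup.summable_of_tendsto_cofinite_zero
  rwa [Nat.cofinite_eq_atTop]

theorem summable_neg_one_pow_mul {f : ℕ → K} (hf : Tendsto f atTop (𝓝 0)) :
    Summable fun m => (-1) ^ m * f m :=
  summable_of_tendsto_nat (squeeze_zero_norm (fun m => (norm_neg_one_pow_mul m (f m)).le)
    (tendsto_zero_iff_norm_tendsto_zero.1 hf))

theorem summable_of_norm_le_mul {a b : ℕ → K} (ha : Tendsto a atTop (𝓝 0))
    (hb : Tendsto b atTop (𝓝 0)) {t : ℕ × ℕ → K} (ht : ∀ q, ‖t q‖ ≤ ‖a q.1‖ * ‖b q.2‖) :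
    Summable t := by
  have : NonarchimedeanRing K := nonarchimedeanRing_of_ultrametric
  have h := (summable_of_tendsto_nat ha).mul_of_nonarchimedean (summable_of_tendsto_nat hb)
  apply NonarchimedeanAddGroup.summable_of_tendsto_cofinite_zero
  refine squeeze_zero_norm (fun q => (ht q).trans (norm_mul _ _).symm.le) ?_
  exact tendsto_zero_iff_norm_tendsto_zero.1 h.tendsto_cofinite_zero

theorem tendsto_antidiagonal {a b : ℕ → K} (ha : Tendsto a atTop (𝓝 0))
    (hb : Tendsto b atTop (𝓝 0)) {t : ℕ × ℕ → K} (ht : ∀ q, ‖t q‖ ≤ ‖a q.1‖ * ‖b q.2‖) :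
    Tendsto (fun n => ∑ q ∈ Finset.HasAntidiagonal.antidiagonal n, t q) atTop (𝓝 0) :=
  (hasSum_antidiagonal (summable_of_norm_le_mul ha hb ht).hasSum).summable.tendsto_atTop_zero

end Ultrametric

section Weights

variable {K : Type*} [NormedField K]

/-- The coefficients of a power series with respect to the basis `(γ X)^m / m!`. -/
def wt (γ : K) (h : K⟦X⟧) (m : ℕ) : K :=
  coeff m h * (m.factorial : K) / γ ^ m

/-- Power series whose coefficients with respect to `(γ X)^m / m!` tend to zero. -/
def WtNull (γ : K) (h : K⟦X⟧) : Prop :=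
  Tendsto (wt γ h) atTop (𝓝 0)

/-- The functional `X^m ↦ (-1)^m m! γ^{-m-1}`, i.e. pairing with the coefficients of
`ζ(γ t) = ∑ (-1)^l l! (γ t)^{-l-1}`. -/
def zetaPair (γ : K) (h : K⟦X⟧) : K :=
  γ⁻¹ * ∑' m, (-1) ^ m * wt γ h m

variable {γ : K}

theorem coeff_eq_wt [CharZero K] (hγ : γ ≠ 0) (h : K⟦X⟧) (m : ℕ) :
    coeff m h = wt γ h m * γ ^ m / (m.factorial : K) := by
  have : (m.factorial : K) ≠ 0 := Nat.cast_ne_zero.2 m.factorial_ne_zero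
  rw [wt]
  field_simp

theorem wt_mul [CharZero K] (hγ : γ ≠ 0) (g h : K⟦X⟧) (m : ℕ) :
    wt γ (g * h) m = ∑ q ∈ Finset.HasAntidiagonal.antidiagonal m,
      wt γ g q.1 * wt γ h q.2 * ((m.choose q.1 : ℕ) : K) := by
  rw [wt, coeff_mul, Finset.sum_mul, Finset.sum_div]
  refine Finset.sum_congr rfl fun q hq => ?_
  have hq' := Finset.HasAntidiagonal.mem_antidiagonal.1 hq
  have h1 : (q.1.factorial : K) ≠ 0 := Nat.cast_ne_zero.2 (Nat.factorial_ne_zero _)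
  have h2 : (q.2.factorial : K) ≠ 0 := Nat.cast_ne_zero.2 (Nat.factorial_ne_zero _)
  have h3 : (m.factorial : K) = (m.choose q.1 : ℕ) * q.1.factorial * q.2.factorial := by
    rw [← Nat.choose_mul_factorial_mul_factorial (Nat.le.intro hq'), ← hq', Nat.add_sub_cancel_left]
    push_cast
    ring
  rw [wt, wt, h3, ← hq', pow_add]
  field_simp

theorem wt_derivative (hγ : γ ≠ 0) (g : K⟦X⟧) (m : ℕ) :
    wt γ (d⁄dX K g) m = γ * wt γ g (m + 1) := by
  rw [wt, wt, coeff_derivative, Nat.factorial_succ, pow_succ]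
  push_cast
  field_simp

theorem wt_add (g h : K⟦X⟧) (m : ℕ) : wt γ (g + h) m = wt γ g m + wt γ h m := by
  simp only [wt, map_add]
  ring

theorem wt_smul (c : K) (g : K⟦X⟧) (m : ℕ) : wt γ (c • g) m = c * wt γ g m := by
  simp only [wt, map_smul, smul_eq_mul]
  ring

theorem zetaPair_smul (c : K) (g : K⟦X⟧) : zetaPair γ (c • g) = c * zetaPair γ g := by
  have h (m : ℕ) : (-1) ^ m * wt γ (c • g) m = c * ((-1) ^ m * wt γ g m) := by
    rw [wt_smul]
    ring
  rw [zetaPair, zetaPair, tsum_congr h, tsum_mul_left]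
  ring

theorem wt_zero (g : K⟦X⟧) : wt γ g 0 = coeff 0 g := by simp [wt]

theorem wtNull_X_pow (q : ℕ) : WtNull γ (X ^ q : K⟦X⟧) := by
  refine tendsto_const_nhds.congr' ?_
  filter_upwards [eventually_gt_atTop q] with m hm
  rw [wt, coeff_X_pow, if_neg hm.ne', zero_mul, zero_div]

theorem wt_mul_X_pow_of_lt (a : K⟦X⟧) {q m : ℕ} (h : m < q) : wt γ (a * X ^ q) m = 0 := by
  rw [wt, coeff_mul_X_pow', if_neg (not_le.2 h), zero_mul, zero_div]

theorem wt_mul_X_pow_add [CharZero K] (hγ : γ ≠ 0) (a : K⟦X⟧) (q i : ℕ) :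
    wt γ (a * X ^ q) (i + q) =
      wt γ a i * ((q.factorial : K) / γ ^ q * ((i + q).choose q : ℕ)) := by
  have h1 : (i.factorial : K) ≠ 0 := Nat.cast_ne_zero.2 (Nat.factorial_ne_zero _)
  rw [wt, coeff_mul_X_pow, wt, ← Nat.add_choose_mul_factorial_mul_factorial i q, pow_add]
  push_cast
  field_simp

theorem tsum_mul_X_pow (a : K⟦X⟧) (q : ℕ) :
    ∑' m, (-1) ^ m * wt γ (a * X ^ q) m = ∑' i, (-1) ^ (i + q) * wt γ (a * X ^ q) (i + q) := by
  refine ((add_left_injective q).tsum_eq (f := fun m => (-1) ^ m * wt γ (a * X ^ q) m) ?_).symm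
  intro m hm
  have : q ≤ m := by
    by_contra h
    exact hm (by simp only [wt_mul_X_pow_of_lt a (not_le.1 h), mul_zero])
  exact ⟨m - q, Nat.sub_add_cancel this⟩

variable [IsUltrametricDist K]

theorem norm_wt_mul_le_one [CharZero K] (hγ : γ ≠ 0) {g h : K⟦X⟧} (hg : ∀ m, ‖wt γ g m‖ ≤ 1)
    (hh : ∀ m, ‖wt γ h m‖ ≤ 1) (m : ℕ) : ‖wt γ (g * h) m‖ ≤ 1 := by
  rw [wt_mul hγ]
  refine IsUltrametricDist.norm_sum_le_of_forall_le_of_nonneg zero_le_one fun q _ => ?_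
  refine (norm_mul_natCast_le _ _).trans ?_
  rw [norm_mul]
  exact mul_le_one₀ (hg _) (norm_nonneg _) (hh _)

theorem norm_zetaPair_mul_X_pow_le [CharZero K] (hγ : γ ≠ 0) {a : K⟦X⟧} (ha : ∀ m, ‖wt γ a m‖ ≤ 1)
    (q : ℕ) : ‖zetaPair γ (a * X ^ q)‖ ≤ ‖(q.factorial : K)‖ / ‖γ‖ ^ (q + 1) := by
  have hp : 0 < ‖γ‖ := norm_pos_iff.2 hγ
  rw [zetaPair, norm_mul, tsum_mul_X_pow, norm_inv, pow_succ', inv_mul_eq_div,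
    div_mul_eq_div_div_swap]
  refine div_le_div_of_nonneg_right ?_ hp.le
  refine IsUltrametricDist.norm_tsum_le_of_forall_le_of_nonneg (by positivity) fun i => ?_
  rw [norm_neg_one_pow_mul, wt_mul_X_pow_add hγ, ← mul_assoc]
  refine (norm_mul_natCast_le _ _).trans ?_
  rw [norm_mul, norm_div, norm_pow]
  exact mul_le_of_le_one_left (by positivity) (ha i)

variable [CompleteSpace K]

theorem WtNull.mul [CharZero K] (hγ : γ ≠ 0) {g h : K⟦X⟧} (hg : WtNull γ g) (hh : WtNull γ h) :
    WtNull γ (g * h) := by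
  have key := tendsto_antidiagonal hg hh
    (t := fun q => wt γ g q.1 * wt γ h q.2 * (((q.1 + q.2).choose q.1 : ℕ) : K))
    (fun q => (norm_mul_natCast_le _ _).trans (norm_mul _ _).le)
  refine key.congr fun m => ?_
  rw [wt_mul hγ]
  refine Finset.sum_congr rfl fun q hq => ?_
  rw [Finset.HasAntidiagonal.mem_antidiagonal.1 hq]

theorem WtNull.zetaPair_derivative_add (hγ : γ ≠ 0) {g : K⟦X⟧} (hg : WtNull γ g) :
    zetaPair γ (d⁄dX K g + γ • g) = coeff 0 g := by
  have hs := summable_neg_one_pow_mul hg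
  have hs1 := (summable_nat_add_iff 1).2 hs
  have h1 : (fun m => (-1) ^ m * wt γ (d⁄dX K g + γ • g) m) = fun m =>
      γ * ((-1) ^ m * wt γ g m - (-1) ^ (m + 1) * wt γ g (m + 1)) := by
    funext m
    rw [wt_add, wt_derivative hγ, wt_smul, pow_succ]
    ring
  rw [zetaPair, h1, tsum_mul_left, hs.tsum_sub hs1, hs.tsum_eq_zero_add,
    add_sub_cancel_right, inv_mul_cancel_left₀ hγ, wt_zero]
  simp

theorem WtNull.exists_primitive [CharZero K] (hγ : γ ≠ 0) {h : K⟦X⟧} (hh : WtNull γ h) :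
    ∃ g, WtNull γ g ∧ d⁄dX K g + γ • g = h := by
  have hsh (m : ℕ) : Tendsto (fun i => wt γ h (i + m)) atTop (𝓝 0) :=
    hh.comp (tendsto_add_atTop_nat m)
  let T : ℕ → K := fun m => ∑' i, (-1) ^ i * wt γ h (i + m)
  have hT (m : ℕ) : T m + T (m + 1) = wt γ h m := by
    have hs := summable_neg_one_pow_mul (hsh m)
    change (∑' i, (-1) ^ i * wt γ h (i + m)) + T (m + 1) = _
    have h1 : T (m + 1) = - ∑' i, (-1) ^ (i + 1) * wt γ h (i + 1 + m) := by
      rw [← tsum_neg]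
      refine tsum_congr fun i => ?_
      rw [pow_succ, add_right_comm, add_assoc]
      ring
    rw [hs.tsum_eq_zero_add, h1]
    simp
  have hT0 : Tendsto T atTop (𝓝 0) := by
    rw [NormedAddGroup.tendsto_nhds_zero]
    intro ε hε
    have := (NormedAddGroup.tendsto_nhds_zero.1 hh) (ε / 2) (half_pos hε)
    obtain ⟨M, hM⟩ := eventually_atTop.1 this
    filter_upwards [eventually_ge_atTop M] with m hm
    refine lt_of_le_of_lt (IsUltrametricDist.norm_tsum_le_of_forall_le_of_nonneg
      (half_pos hε).le fun i => ?_) (half_lt_self hε)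
    rw [norm_neg_one_pow_mul]
    exact (hM _ (by omega)).le
  let g : K⟦X⟧ := PowerSeries.mk fun m => γ⁻¹ * T m * γ ^ m / (m.factorial : K)
  have hw (m : ℕ) : wt γ g m = γ⁻¹ * T m := by
    have : (m.factorial : K) ≠ 0 := Nat.cast_ne_zero.2 m.factorial_ne_zero
    rw [wt, coeff_mk]
    field_simp
  refine ⟨g, ?_, ?_⟩
  · have := hT0.const_mul γ⁻¹
    rw [mul_zero] at this
    exact this.congr fun m => (hw m).symm
  · ext m
    rw [coeff_eq_wt hγ, coeff_eq_wt hγ h, wt_add, wt_derivative hγ, wt_smul, hw, hw,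
      mul_inv_cancel_left₀ hγ, mul_inv_cancel_left₀ hγ, add_comm, hT]

theorem zetaPair_ne_zero (hγ : γ ≠ 0) {a : K⟦X⟧} {r : ℝ} (hr : r < 1) (h0 : coeff 0 a = 1)
    (ha : ∀ m, ‖wt γ a (m + 1)‖ ≤ r) (hn : WtNull γ a) : zetaPair γ a ≠ 0 := by
  rw [zetaPair, (summable_neg_one_pow_mul hn).tsum_eq_zero_add, wt_zero, h0]
  refine mul_ne_zero (inv_ne_zero hγ) fun h => ?_
  have h1 : ‖∑' m, (-1) ^ (m + 1) * wt γ a (m + 1)‖ ≤ r :=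
    IsUltrametricDist.norm_tsum_le_of_forall_le_of_nonneg ((norm_nonneg _).trans (ha 0))
      fun m => (norm_neg_one_pow_mul _ _).le.trans (ha m)
  have h2 : ‖∑' m, (-1) ^ (m + 1) * wt γ a (m + 1)‖ = 1 := by
    rw [pow_zero, mul_one, add_comm] at h
    rw [eq_neg_of_add_eq_zero_left h, norm_neg, norm_one]
  linarith

theorem hasSum_coeff_mul_zetaPair [CharZero K] (hγ : γ ≠ 0) {a h : K⟦X⟧} (ha : WtNull γ a)
    (hh : WtNull γ h) :
    HasSum (fun j => coeff j h * zetaPair γ (a * X ^ j)) (zetaPair γ (a * h)) := by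
  let t : ℕ × ℕ → K := fun q =>
    (-1) ^ (q.1 + q.2) * (wt γ a q.1 * wt γ h q.2 * (((q.1 + q.2).choose q.1 : ℕ) : K))
  have ht : Summable t := summable_of_norm_le_mul ha hh fun q => by
    rw [norm_neg_one_pow_mul]
    exact (norm_mul_natCast_le _ _).trans (norm_mul _ _).le
  have h1 : HasSum (fun m => (-1) ^ m * wt γ (a * h) m) (∑' q, t q) := by
    convert hasSum_antidiagonal ht.hasSum using 2 with m
    rw [wt_mul hγ, Finset.mul_sum]
    refine Finset.sum_congr rfl fun q hq => ?_
    rw [← Finset.HasAntidiagonal.mem_antidiagonal.1 hq]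
  have h2 : HasSum (fun j => coeff j h * ∑' m, (-1) ^ m * wt γ (a * X ^ j) m) (∑' q, t q) := by
    refine hasSum_of_hasSum_fiber ht.hasSum fun j => ?_
    rw [tsum_mul_X_pow, ← tsum_mul_left]
    have hs : Summable fun i => t (i, j) :=
      ht.comp_injective (Prod.mk_left_injective j)
    have : (fun i => t (i, j)) =
        fun i => coeff j h * ((-1) ^ (i + j) * wt γ (a * X ^ j) (i + j)) := by
      funext i
      have hj : (j.factorial : K) ≠ 0 := Nat.cast_ne_zero.2 (Nat.factorial_ne_zero _)
      simp only [t]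
      rw [wt_mul_X_pow_add hγ, coeff_eq_wt hγ h, Nat.choose_symm_add]
      field_simp
    rw [← this]
    exact hs.hasSum
  have h3 := h2.mul_left γ⁻¹
  have h4 (j : ℕ) : γ⁻¹ * (coeff j h * ∑' m, (-1) ^ m * wt γ (a * X ^ j) m) =
      coeff j h * zetaPair γ (a * X ^ j) := by
    rw [zetaPair]
    ring
  rw [zetaPair, h1.tsum_eq]
  simpa only [h4] using h3

end Weights

section PadicEstimates

variable (p : ℕ) [hp : Fact p.Prime]

theorem inv_prime_pos : (0 : ℝ) < (p : ℝ)⁻¹ := inv_pos.2 (by exact_mod_cast hp.1.pos)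

theorem inv_prime_lt_one : (p : ℝ)⁻¹ < 1 := inv_lt_one_of_one_lt₀ (by exact_mod_cast hp.1.one_lt)

/-- The real number `p^{-1/p}`. -/
def rad : ℝ := ((p : ℝ)⁻¹) ^ (1 / (p : ℝ))

theorem rad_pos : 0 < rad p := Real.rpow_pos_of_pos (inv_prime_pos p) _

theorem rad_lt_one : rad p < 1 :=
  Real.rpow_lt_one (inv_prime_pos p).le (inv_prime_lt_one p)
    (one_div_pos.2 (by exact_mod_cast hp.1.pos))

theorem rad_pow : rad p ^ p = (p : ℝ)⁻¹ := by
  rw [rad, one_div]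
  exact Real.rpow_inv_natCast_pow (inv_prime_pos p).le hp.1.ne_zero

theorem tendsto_rad_pow : Tendsto (fun m : ℕ => rad p ^ m) atTop (𝓝 0) :=
  tendsto_pow_atTop_nhds_zero_of_lt_one (rad_pos p).le (rad_lt_one p)

variable {K : Type*} [NormedField K]

theorem gamma_ne_zero {γ : K} (hγ : ‖γ‖ ^ (p - 1) = (p : ℝ)⁻¹)
    : γ ≠ 0 := by
  rintro rfl
  have h := hp.1.one_lt
  rw [norm_zero, zero_pow (by omega)] at hγ
  exact (inv_prime_pos p).ne hγ

theorem norm_gamma_le_one {γ : K} (hγ : ‖γ‖ ^ (p - 1) = (p : ℝ)⁻¹)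
    : ‖γ‖ ≤ 1 := by
  have h := hp.1.one_lt
  by_contra hh
  have := one_le_pow₀ (not_le.1 hh).le (n := p - 1)
  rw [hγ] at this
  exact absurd (inv_prime_lt_one p) (not_lt.2 this)

variable [NormedAlgebra ℚ_[p] K]

theorem norm_natCast_eq_pow (n : ℕ) (hn : n ≠ 0) :
    ‖(n : K)‖ = (p : ℝ)⁻¹ ^ padicValNat p n := by
  have h0 : (n : ℚ_[p]) ≠ 0 := Nat.cast_ne_zero.2 hn
  rw [← map_natCast (algebraMap ℚ_[p] K), norm_algebraMap', Padic.norm_eq_zpow_neg_valuation h0,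
    Padic.valuation_natCast, zpow_neg, zpow_natCast, inv_pow]

theorem norm_prime : ‖(p : K)‖ = (p : ℝ)⁻¹ := by
  rw [norm_natCast_eq_pow p p hp.1.ne_zero, padicValNat_self, pow_one]

theorem norm_factorial_mul (n : ℕ) :
    ‖((p * n).factorial : K)‖ = (p : ℝ)⁻¹ ^ n * ‖(n.factorial : K)‖ := by
  rw [norm_natCast_eq_pow p _ (Nat.factorial_ne_zero _),
    norm_natCast_eq_pow p _ (Nat.factorial_ne_zero _), padicValNat_factorial_mul, pow_add, mul_comm]

variable [IsUltrametricDist K]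

theorem norm_factorial_le (n : ℕ) : ‖(n.factorial : K)‖ ≤ (p : ℝ)⁻¹ ^ (n / p) := by
  have h1 : ‖(n.factorial : K)‖ ≤ ‖((p * (n / p)).factorial : K)‖ :=
    norm_natCast_le_of_dvd (Nat.factorial_dvd_factorial (Nat.mul_div_le n p))
  refine h1.trans ?_
  rw [norm_factorial_mul]
  exact mul_le_of_le_one_right (pow_nonneg (inv_prime_pos p).le _)
    (IsUltrametricDist.norm_natCast_le_one K _)

theorem tendsto_factorial_zero (K : Type*) [NormedField K] [NormedAlgebra ℚ_[p] K]
    [IsUltrametricDist K] : Tendsto (fun n : ℕ => (n.factorial : K)) atTop (𝓝 0) := by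
  refine squeeze_zero_norm (norm_factorial_le p) ?_
  exact (tendsto_pow_atTop_nhds_zero_of_lt_one (inv_prime_pos p).le (inv_prime_lt_one p)).comp
    (Nat.tendsto_div_const_atTop hp.1.ne_zero)

theorem norm_factorial_pow_le (i : ℕ) (hi : i ≠ 0) :
    ‖((p ^ i).factorial : K)‖ ≤ rad p ^ p ^ i := by
  obtain ⟨k, rfl⟩ := Nat.exists_eq_succ_of_ne_zero hi
  rw [Nat.succ_eq_add_one, pow_succ', norm_factorial_mul, pow_mul, rad_pow]
  exact mul_le_of_le_one_right (pow_nonneg (inv_prime_pos p).le _)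
    (IsUltrametricDist.norm_natCast_le_one K _)

theorem norm_wt_expLac_le [Algebra ℚ K] [CharZero K] {γ : K} (hγ : γ ≠ 0) (c : ℕ → K)
    (hc0 : c 0 = 0) (hc : ∀ i, i ≠ 0 → ‖c i‖ ≤ ‖γ‖ ^ p ^ i) (m : ℕ) :
    ‖wt γ (expLac p c) m‖ ≤ rad p ^ m := by
  have hlac (k : ℕ) : ‖wt γ (lacSeries p c) k‖ ≤ rad p ^ k := by
    by_cases h : ∃ i, k = p ^ i
    · obtain ⟨i, rfl⟩ := h
      rw [wt, coeff_lacSeries_pow]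
      rcases eq_or_ne i 0 with rfl | hi
      · simp [hc0, (rad_pos p).le]
      · have h0 : 0 < ‖γ‖ ^ p ^ i := pow_pos (norm_pos_iff.2 hγ) _
        rw [norm_div, norm_mul, norm_pow, div_le_iff₀ h0, mul_comm]
        exact mul_le_mul (norm_factorial_pow_le p i hi) (hc i hi) (norm_nonneg _)
          (pow_nonneg (rad_pos p).le _)
    · push Not at h
      rw [wt, coeff_lacSeries_of_ne p c h]
      simp [(rad_pos p).le]
  induction m using Nat.strong_induction_on with
  | _ m ih =>
  cases m with
  | zero => simp [wt_zero, constantCoeff_expLac]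
  | succ m =>
    have h1 : wt γ (expLac p c) (m + 1) = ∑ q ∈ Finset.HasAntidiagonal.antidiagonal m,
        wt γ (lacSeries p c) (q.1 + 1) * wt γ (expLac p c) q.2 * ((m.choose q.1 : ℕ) : K) := by
      apply mul_left_cancel₀ hγ
      rw [← wt_derivative hγ, derivative_expLac, wt_mul hγ, Finset.mul_sum]
      refine Finset.sum_congr rfl fun q _ => ?_
      rw [wt_derivative hγ]
      ring
    rw [h1]
    refine IsUltrametricDist.norm_sum_le_of_forall_le_of_nonneg (pow_nonneg (rad_pos p).le _) ?_
    intro q hq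
    have hq' := Finset.HasAntidiagonal.mem_antidiagonal.1 hq
    refine (norm_mul_natCast_le _ _).trans ?_
    have h2 : m + 1 = q.1 + 1 + q.2 := by omega
    rw [norm_mul, h2, pow_add]
    exact mul_le_mul (hlac _) (ih _ (by omega)) (norm_nonneg _) (pow_nonneg (rad_pos p).le _)

theorem wtNull_expLac [Algebra ℚ K] [CharZero K] {γ : K} (hγ : γ ≠ 0) (c : ℕ → K)
    (hc0 : c 0 = 0) (hc : ∀ i, i ≠ 0 → ‖c i‖ ≤ ‖γ‖ ^ p ^ i) : WtNull γ (expLac p c) :=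
  squeeze_zero_norm (norm_wt_expLac_le p hγ c hc0 hc) (tendsto_rad_pow p)

/-- The partial sums `∑_{i ≤ j} γ^{p^i} / p^i`. -/
def gamSum (γ : K) (j : ℕ) : K :=
  ∑ i ∈ Finset.range (j + 1), γ ^ (p ^ i) / (p : K) ^ i

theorem exists_pow_eq_add (j i : ℕ) (hi : j + 1 ≤ i) :
    ∃ s, i ≤ s ∧ p ^ i = p ^ j + (p - 1) * s := by
  have hp1 : p = 1 + (p - 1) := by have := hp.1.one_lt; omega
  have hstep (k : ℕ) : p ^ (k + 1) = p ^ k + (p - 1) * p ^ k := by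
    conv_lhs => rw [pow_succ', hp1]
    rw [add_mul, one_mul, ← hp1]
  induction i, hi using Nat.le_induction with
  | base => exact ⟨p ^ j, Nat.lt_pow_self hp.1.one_lt, hstep j⟩
  | succ i hi ih =>
    obtain ⟨s, hs, h⟩ := ih
    refine ⟨s + p ^ i, by have := pow_pos hp.1.pos i; omega, ?_⟩
    rw [hstep i]
    conv_lhs => rw [h]
    rw [mul_add]
    conv_rhs => rw [h]
    ring

theorem norm_gamSum_le {γ : K} (hγ : ‖γ‖ ^ (p - 1) = (p : ℝ)⁻¹)
    (hs : HasSum (fun i : ℕ => γ ^ (p ^ i) / (p : K) ^ i) 0) (j : ℕ) : ‖gamSum p γ j‖ ≤ ‖γ‖ ^ p ^ j := by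
  have hterm (i : ℕ) (hi : j + 1 ≤ i) : ‖γ ^ (p ^ i) / (p : K) ^ i‖ ≤ ‖γ‖ ^ p ^ j := by
    obtain ⟨s, hs, h⟩ := exists_pow_eq_add p j i hi
    have hpos := pow_pos (inv_prime_pos p) i
    rw [norm_div, norm_pow, norm_pow, norm_prime, h, pow_add, pow_mul, hγ, div_le_iff₀ hpos]
    exact mul_le_mul_of_nonneg_left
      (pow_le_pow_of_le_one (inv_prime_pos p).le (inv_prime_lt_one p).le hs) (by positivity)
  have hlim : Tendsto (fun n => gamSum p γ n) atTop (𝓝 0) :=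
    hs.tendsto_sum_nat.comp (tendsto_add_atTop_nat 1)
  have hlim2 : Tendsto (fun n => ‖gamSum p γ n - gamSum p γ j‖) atTop (𝓝 ‖0 - gamSum p γ j‖) :=
    (hlim.sub_const _).norm
  rw [zero_sub, norm_neg] at hlim2
  refine le_of_tendsto hlim2 ?_
  filter_upwards [eventually_ge_atTop j] with n hn
  have : gamSum p γ n - gamSum p γ j =
      ∑ i ∈ Finset.Ico (j + 1) (n + 1), γ ^ (p ^ i) / (p : K) ^ i := by
    rw [gamSum, gamSum, Finset.sum_Ico_eq_sub _ (by omega)]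
  rw [this]
  exact IsUltrametricDist.norm_sum_le_of_forall_le_of_nonneg (by positivity)
    fun i hi => hterm i (Finset.mem_Ico.1 hi).1

end PadicEstimates

section Sections

variable {K : Type*} [Field K] (p : ℕ)

/-- The operator `∑ g_m X^m ↦ ∑ g_{p m + r} X^m`. -/
def sectionOp (r : ℕ) (g : K⟦X⟧) : K⟦X⟧ :=
  PowerSeries.mk fun m => coeff (p * m + r) g

theorem coeff_sectionOp (r m : ℕ) (g : K⟦X⟧) :
    coeff m (sectionOp p r g) = coeff (p * m + r) g := coeff_mk _ _

variable [hp : Fact p.Prime]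

theorem sectionOp_expand_mul (r : ℕ) (hr : r < p) (a b : K⟦X⟧) :
    sectionOp p r (expand p hp.1.ne_zero a * b) = a * sectionOp p r b := by
  ext m
  rw [coeff_sectionOp, coeff_mul, coeff_mul]
  symm
  refine Finset.sum_of_injOn (fun q => (p * q.1, p * q.2 + r)) ?_ ?_ ?_ ?_
  · rintro ⟨i, j⟩ _ ⟨i', j'⟩ _ h
    simp only [Prod.mk.injEq, add_left_inj, mul_eq_mul_left_iff, hp.1.ne_zero, or_false] at h
    exact Prod.ext h.1 h.2
  · rintro ⟨i, j⟩ h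
    have h' := Finset.HasAntidiagonal.mem_antidiagonal.1 h
    refine Finset.HasAntidiagonal.mem_antidiagonal.2 ?_
    dsimp only at h' ⊢
    rw [← h']
    ring
  · rintro ⟨i, j⟩ h hn
    have h' := Finset.HasAntidiagonal.mem_antidiagonal.1 h
    dsimp only at h' ⊢
    by_cases hd : p ∣ i
    · exfalso
      obtain ⟨k, rfl⟩ := hd
      have hk : k ≤ m := by
        by_contra hk
        have := Nat.mul_le_mul_left p (Nat.succ_le_of_lt (not_le.1 hk))
        rw [Nat.mul_succ] at this
        omega
      obtain ⟨l, rfl⟩ := Nat.exists_eq_add_of_le hk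
      refine hn ⟨(k, l), Finset.mem_coe.2 (Finset.HasAntidiagonal.mem_antidiagonal.2 rfl), ?_⟩
      rw [mul_add] at h'
      exact Prod.ext rfl (by dsimp only; omega)
    · rw [coeff_expand_of_not_dvd _ _ _ hd, zero_mul]
  · rintro ⟨i, j⟩ _
    rw [coeff_expand_mul, coeff_sectionOp]

theorem sectionOp_derivative (g : K⟦X⟧) :
    sectionOp p (p - 1) (d⁄dX K g) = (p : K) • d⁄dX K (sectionOp p 0 g) := by
  ext m
  have h : p * m + (p - 1) + 1 = p * (m + 1) := by
    have := hp.1.one_lt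
    rw [mul_add]
    omega
  rw [coeff_sectionOp, coeff_derivative, h, map_smul, coeff_derivative, coeff_sectionOp, add_zero,
    smul_eq_mul]
  have h2 : ((p * m + (p - 1) : ℕ) : K) + 1 = p * (m + 1) := by
    exact_mod_cast congrArg (Nat.cast (R := K)) h
  rw [h2]
  ring

end Sections

section Frobenius

variable (p : ℕ) [hp : Fact p.Prime] {K : Type*} [NormedField K] [Algebra ℚ K] [CharZero K]

/-- `θ(t) = AH(γ t)`. -/
def dworkTheta (γ : K) : K⟦X⟧ := rescale γ (expLac p fun i => 1 / (p : K) ^ i)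

/-- `exp (∑_{j ≥ 1} γ_j t^{p^j})`. -/
def hatOne (γ : K) : K⟦X⟧ := expLac p fun j => if j = 0 then 0 else gamSum p γ j

variable {γ : K}

theorem exp_mul_hatOne :
    rescale γ (PowerSeries.exp K) * hatOne p γ = expLac p (gamSum p γ) := by
  rw [← expLac_single p, hatOne, ← expLac_add]
  congr 1
  funext j
  rcases eq_or_ne j 0 with rfl | hj
  · simp [gamSum]
  · simp [hj]

theorem dworkTheta_mul_expand :
    dworkTheta p γ * expand p hp.1.ne_zero (expLac p (gamSum p γ)) = expLac p (gamSum p γ) := by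
  rw [dworkTheta, rescale_expLac, expand_expLac, ← expLac_add]
  congr 1
  funext j
  rcases eq_or_ne j 0 with rfl | hj
  · simp [gamSum]
  · obtain ⟨k, rfl⟩ := Nat.exists_eq_succ_of_ne_zero hj
    simp only [Pi.add_apply, Nat.succ_ne_zero, if_false, Nat.succ_eq_add_one, Nat.add_sub_cancel]
    rw [gamSum, gamSum, Finset.sum_range_succ _ (k + 1)]
    ring

variable [NormedAlgebra ℚ_[p] K]

theorem norm_coeff_dworkTheta_le (m : ℕ) : ‖coeff m (dworkTheta p γ)‖ ≤ ‖γ‖ ^ m := by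
  rw [dworkTheta, coeff_rescale, norm_mul, norm_pow]
  exact mul_le_of_le_one_right (by positivity) (norm_coeff_artinHasse_le p K m)

variable [IsUltrametricDist K]

theorem norm_wt_hatOne_le (hγ : ‖γ‖ ^ (p - 1) = (p : ℝ)⁻¹)
    (hs : HasSum (fun i : ℕ => γ ^ (p ^ i) / (p : K) ^ i) 0) (m : ℕ) : ‖wt γ (hatOne p γ) m‖ ≤ rad p ^ m := by
  refine norm_wt_expLac_le p (gamma_ne_zero p hγ) _ (if_pos rfl) (fun i hi => ?_) m
  rw [if_neg hi]
  exact norm_gamSum_le p hγ hs i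

theorem exists_hatOne_inv (hγ : ‖γ‖ ^ (p - 1) = (p : ℝ)⁻¹)
    (hs : HasSum (fun i : ℕ => γ ^ (p ^ i) / (p : K) ^ i) 0) : ∃ b : K⟦X⟧, WtNull γ b ∧ hatOne p γ * b = 1 := by
  refine ⟨_, ?_, expLac_mul_neg p _⟩
  refine wtNull_expLac p (gamma_ne_zero p hγ) _ (by simp) fun i hi => ?_
  rw [Pi.neg_apply, norm_neg, if_neg hi]
  exact norm_gamSum_le p hγ hs i

theorem wtNull_hatOne (hγ : ‖γ‖ ^ (p - 1) = (p : ℝ)⁻¹)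
    (hs : HasSum (fun i : ℕ => γ ^ (p ^ i) / (p : K) ^ i) 0) : WtNull γ (hatOne p γ) :=
  squeeze_zero_norm (norm_wt_hatOne_le p hγ hs) (tendsto_rad_pow p)

theorem wtNull_sectionOp_mul_X_pow (hγ : ‖γ‖ ^ (p - 1) = (p : ℝ)⁻¹)
    (q : ℕ) :
    WtNull γ (sectionOp p (p - 1) (dworkTheta p γ * X ^ q)) := by
  have hγ0 := gamma_ne_zero p hγ
  have hg : 0 < ‖γ‖ := norm_pos_iff.2 hγ0
  have hlim : Tendsto (fun m : ℕ => (p : ℝ)⁻¹ ^ m / ‖γ‖ ^ q) atTop (𝓝 0) := by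
    have := (tendsto_pow_atTop_nhds_zero_of_lt_one (inv_prime_pos p).le
      (inv_prime_lt_one p)).div_const (‖γ‖ ^ q)
    rwa [zero_div] at this
  refine squeeze_zero_norm (fun m => ?_) hlim
  rw [wt, coeff_sectionOp, norm_div, norm_pow]
  refine (div_le_div_of_nonneg_right (norm_mul_natCast_le _ _) (by positivity)).trans ?_
  rw [div_le_div_iff₀ (by positivity) (by positivity), coeff_mul_X_pow']
  split_ifs with h
  · calc ‖coeff (p * m + (p - 1) - q) (dworkTheta p γ)‖ * ‖γ‖ ^ q
        ≤ ‖γ‖ ^ (p * m + (p - 1) - q) * ‖γ‖ ^ q := by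
          gcongr
          exact norm_coeff_dworkTheta_le p _
      _ = ‖γ‖ ^ ((p - 1) * m + m + (p - 1)) := by
          rw [← pow_add, Nat.sub_add_cancel h]
          congr 2
          obtain ⟨k, hk⟩ := Nat.exists_eq_add_of_lt hp.1.pos
          rw [hk]
          simp only [zero_add, Nat.add_sub_cancel]
          ring
      _ ≤ ‖γ‖ ^ ((p - 1) * m + m) :=
          pow_le_pow_of_le_one hg.le (norm_gamma_le_one p hγ) (Nat.le_add_right _ _)
      _ = (p : ℝ)⁻¹ ^ m * ‖γ‖ ^ m := by rw [pow_add, pow_mul, hγ]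
  · rw [norm_zero, zero_mul]
    have := inv_prime_pos p
    positivity

variable [CompleteSpace K]

theorem wtNull_sectionOp_zero (hγ : ‖γ‖ ^ (p - 1) = (p : ℝ)⁻¹)
    {f : K⟦X⟧} (hf : WtNull γ f) :
    WtNull γ (sectionOp p 0 (dworkTheta p γ * f)) := by
  have hγ0 := gamma_ne_zero p hγ
  let t : ℕ × ℕ → K := fun q => if p ∣ q.1 + q.2 then
    coeff q.1 (dworkTheta p γ) * coeff q.2 f * (((q.1 + q.2) / p).factorial : K) /
      γ ^ ((q.1 + q.2) / p) else 0
  have ht (q : ℕ × ℕ) : ‖t q‖ ≤ ‖(q.1.factorial : K)‖ * ‖wt γ f q.2‖ := by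
    by_cases hd : p ∣ q.1 + q.2
    · obtain ⟨m, hm⟩ := id hd
      simp only [t, if_pos hd]
      rw [hm, Nat.mul_div_cancel_left _ hp.1.pos, norm_div, norm_mul, norm_mul, norm_pow,
        coeff_eq_wt hγ0 f, norm_div, norm_mul, norm_pow]
      have hg : 0 < ‖γ‖ := norm_pos_iff.2 hγ0
      have hj : 0 < ‖(q.2.factorial : K)‖ :=
        norm_pos_iff.2 (Nat.cast_ne_zero.2 (Nat.factorial_ne_zero _))
      have h1 : ‖γ‖ ^ q.1 * ‖γ‖ ^ q.2 = (p : ℝ)⁻¹ ^ m * ‖γ‖ ^ m := by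
        rw [← pow_add, hm, ← hγ, ← pow_mul, ← pow_add]
        congr 1
        obtain ⟨k, hk⟩ := Nat.exists_eq_add_of_lt hp.1.pos
        rw [hk]
        simp only [zero_add, Nat.add_sub_cancel]
        ring
      have h2 : (p : ℝ)⁻¹ ^ m * ‖(m.factorial : K)‖ ≤
          ‖(q.1.factorial : K)‖ * ‖(q.2.factorial : K)‖ := by
        rw [← norm_factorial_mul, ← hm, ← norm_mul, ← Nat.cast_mul]
        exact norm_natCast_le_of_dvd (Nat.factorial_mul_factorial_dvd_factorial_add _ _)
      have h3 := norm_coeff_dworkTheta_le p (γ := γ) q.1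
      rw [div_le_iff₀ (pow_pos hg m), mul_div_assoc', div_mul_eq_mul_div, div_le_iff₀ hj]
      calc ‖coeff q.1 (dworkTheta p γ)‖ * (‖wt γ f q.2‖ * ‖γ‖ ^ q.2) * ‖(m.factorial : K)‖
          ≤ ‖γ‖ ^ q.1 * (‖wt γ f q.2‖ * ‖γ‖ ^ q.2) * ‖(m.factorial : K)‖ := by gcongr
        _ = ((p : ℝ)⁻¹ ^ m * ‖(m.factorial : K)‖) * (‖γ‖ ^ m * ‖wt γ f q.2‖) := by
          linear_combination ‖wt γ f q.2‖ * ‖(m.factorial : K)‖ * h1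
        _ ≤ (‖(q.1.factorial : K)‖ * ‖(q.2.factorial : K)‖) * (‖γ‖ ^ m * ‖wt γ f q.2‖) := by gcongr
        _ = _ := by ring
    · simp only [t, if_neg hd, norm_zero]
      positivity
  have key := (tendsto_antidiagonal (tendsto_factorial_zero p K) hf ht).comp
    (tendsto_id.const_mul_atTop' hp.1.pos)
  refine key.congr fun m => ?_
  rw [wt, coeff_sectionOp, add_zero, coeff_mul, Finset.sum_mul, Finset.sum_div]
  refine Finset.sum_congr rfl fun q hq => ?_
  have hq' : q.1 + q.2 = p * m := Finset.HasAntidiagonal.mem_antidiagonal.1 hq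
  simp only [t, hq', dvd_mul_right, if_true, Nat.mul_div_cancel_left _ hp.1.pos]

theorem zetaPair_sectionOp (hγ : ‖γ‖ ^ (p - 1) = (p : ℝ)⁻¹)
    (hs : HasSum (fun i : ℕ => γ ^ (p ^ i) / (p : K) ^ i) 0) {h : K⟦X⟧} (hh : WtNull γ h) :
    zetaPair γ (hatOne p γ * sectionOp p (p - 1) (dworkTheta p γ * h)) =
      p * zetaPair γ (hatOne p γ * h) := by
  have hγ0 := gamma_ne_zero p hγ
  have hH := wtNull_hatOne p hγ hs
  obtain ⟨b, hb, hb1⟩ := exists_hatOne_inv p hγ hs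
  obtain ⟨g, hg, hgh⟩ := (hH.mul hγ0 hh).exists_primitive hγ0
  set e := rescale γ (PowerSeries.exp K) with he
  set T := expLac p (gamSum p γ)
  have heT : e * hatOne p γ = T := exp_mul_hatOne p
  have hT : dworkTheta p γ * expand p hp.1.ne_zero T = T := dworkTheta_mul_expand p
  have hde : d⁄dX K e = γ • e := by
    have h1 := derivative_expLac p (Pi.single 0 γ : ℕ → K)
    rw [expLac_single, lacSeries_single, Derivation.map_smul, derivative_X, smul_one_mul] at h1
    exact h1
  have hprod (f : K⟦X⟧) : d⁄dX K (e * f) = e * (d⁄dX K f + γ • f) := by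
    rw [Derivation.leibniz, hde, smul_eq_mul, smul_eq_mul, mul_add, mul_smul_comm, mul_smul_comm,
      mul_comm f]
  have he0 : e ≠ 0 := by
    intro h0
    have := congrArg (coeff 0) h0
    rw [he] at this
    simp at this
  set f := b * g
  have hf : WtNull γ f := hb.mul hγ0 hg
  have hfg : g = hatOne p γ * f := by
    rw [← mul_assoc, hb1, one_mul]
  set g' := hatOne p γ * sectionOp p 0 (dworkTheta p γ * f)
  have hg' : WtNull γ g' := hH.mul hγ0 (wtNull_sectionOp_zero p hγ hf)
  have hU : sectionOp p 0 (e * g) = e * g' := by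
    have : e * g = expand p hp.1.ne_zero T * (dworkTheta p γ * f) := by
      rw [hfg, ← mul_assoc, heT]
      conv_lhs => rw [← hT]
      ring
    rw [this, sectionOp_expand_mul p 0 hp.1.pos, ← heT, mul_assoc]
  have hmain : hatOne p γ * sectionOp p (p - 1) (dworkTheta p γ * h) =
      (p : K) • (d⁄dX K g' + γ • g') := by
    apply mul_left_cancel₀ he0
    have h1 : expand p hp.1.ne_zero T * (dworkTheta p γ * h) = d⁄dX K (e * g) := by
      rw [hprod, hgh, ← mul_assoc, ← mul_assoc, heT, mul_comm (expand p hp.1.ne_zero T), hT]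
    rw [← mul_assoc, heT, ← sectionOp_expand_mul p (p - 1) (Nat.sub_lt hp.1.pos one_pos), h1,
      sectionOp_derivative, hU, hprod, mul_smul_comm]
  have h0 : coeff 0 g' = coeff 0 g := by
    rw [hfg]
    simp only [g', coeff_zero_eq_constantCoeff, map_mul]
    congr 1
    rw [← coeff_zero_eq_constantCoeff_apply, coeff_sectionOp]
    have h1 : constantCoeff (dworkTheta p γ) = 1 := by
      rw [← coeff_zero_eq_constantCoeff_apply, dworkTheta, coeff_rescale, coeff_zero_expLac,
        pow_zero, mul_one]
    simp [h1]
  rw [hmain, zetaPair_smul, hg'.zetaPair_derivative_add hγ0, h0, ← hgh,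
    hg.zetaPair_derivative_add hγ0]

theorem hasSum_coeff_sectionOp_mul_zetaPair (hγ : ‖γ‖ ^ (p - 1) = (p : ℝ)⁻¹)
    (hs : HasSum (fun i : ℕ => γ ^ (p ^ i) / (p : K) ^ i) 0) (q : ℕ) :
    HasSum (fun m => coeff m (sectionOp p (p - 1) (dworkTheta p γ * X ^ q)) *
      zetaPair γ (hatOne p γ * X ^ m)) (p * zetaPair γ (hatOne p γ * X ^ q)) := by
  have hγ0 := gamma_ne_zero p hγ
  rw [← zetaPair_sectionOp p hγ hs (wtNull_X_pow q)]
  exact hasSum_coeff_mul_zetaPair hγ0 (wtNull_hatOne p hγ hs) (wtNull_sectionOp_mul_X_pow p hγ q)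

end Frobenius

theorem hasSum_prod_fin {K : Type*} [NormedField K] [IsUltrametricDist K] {κ : Type*} (N : ℕ)
    (f : Fin N → κ → K) (s : Fin N → K) (h : ∀ j, HasSum (f j) (s j)) :
    HasSum (fun x : Fin N → κ => ∏ j, f j (x j)) (∏ j, s j) := by
  have : NonarchimedeanRing K := nonarchimedeanRing_of_ultrametric
  induction N with
  | zero => simp
  | succ N ih =>
    rw [Fin.prod_univ_succ, ← (Fin.consEquiv fun _ => κ).hasSum_iff]
    convert (h 0).mul_of_nonarchimedean (ih (fun j => f j.succ) (fun j => s j.succ)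
      fun j => h j.succ) using 2 with x
    simp [Fin.prod_univ_succ, Fin.consEquiv]

variable {p : ℕ} [hp : Fact p.Prime] {n N : ℕ}

section OneVariable

theorem coeffZ_of_neg (f : PowerSeries ℂ_[p]) {k : ℤ} (hk : k < 0) : coeffZ f k = 0 :=
  if_neg (not_le.2 hk)

theorem coeffZ_natCast (f : PowerSeries ℂ_[p]) (m : ℕ) : coeffZ f (m : ℤ) = coeff m f := by
  simp [coeffZ]

theorem coeffZ_sub_natCast (f : PowerSeries ℂ_[p]) (m q : ℕ) :
    coeffZ f ((m : ℤ) - q) = coeff m (f * X ^ q) := by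
  rw [coeff_mul_X_pow']
  split_ifs with h
  · rw [← Nat.cast_sub h, coeffZ_natCast]
  · exact coeffZ_of_neg f (by omega)

theorem hasSum_coeffZ_mul (f g : PowerSeries ℂ_[p]) (k : ℤ) :
    HasSum (fun x => coeffZ f x * coeffZ g (k - x)) (coeffZ (f * g) k) := by
  have hzero (x : ℤ) (hx : ¬ (0 ≤ x ∧ x ≤ k)) : coeffZ f x * coeffZ g (k - x) = 0 := by
    rcases lt_or_ge x 0 with h | h
    · rw [coeffZ_of_neg f h, zero_mul]
    · rw [coeffZ_of_neg g (by omega), mul_zero]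
  rcases lt_or_ge k 0 with hk | hk
  · rw [coeffZ_of_neg _ hk]
    convert hasSum_zero (α := ℂ_[p]) (β := ℤ) using 2 with x
    exact hzero x (by omega)
  · obtain ⟨m, rfl⟩ := Int.eq_ofNat_of_zero_le hk
    have h1 : coeffZ (f * g) m = ∑ x ∈ (Finset.range (m + 1)).map Nat.castEmbedding,
        coeffZ f x * coeffZ g ((m : ℤ) - x) := by
      rw [coeffZ_natCast, coeff_mul, Finset.sum_map,
        Finset.Nat.sum_antidiagonal_eq_sum_range_succ fun i j => coeff i f * coeff j g]
      refine Finset.sum_congr rfl fun i hi => ?_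
      have hi' := Finset.mem_range.1 hi
      rw [Nat.castEmbedding_apply, coeffZ_natCast, ← Nat.cast_sub (by omega), coeffZ_natCast]
    rw [h1]
    refine hasSum_sum_of_ne_finset_zero fun x hx => hzero x fun hh => hx ?_
    obtain ⟨i, rfl⟩ := Int.eq_ofNat_of_zero_le hh.1
    exact Finset.mem_map.2 ⟨i, Finset.mem_range.2 (by omega), rfl⟩

theorem coeffZ_expand (f : PowerSeries ℂ_[p]) (k : ℤ) :
    coeffZ (expand p hp.1.ne_zero f) k = if (p : ℤ) ∣ k then coeffZ f (k / p) else 0 := by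
  have hp0 : (0 : ℤ) < p := by exact_mod_cast hp.1.pos
  rcases lt_or_ge k 0 with hk | hk
  · rw [coeffZ_of_neg _ hk]
    split_ifs with h
    · rw [coeffZ_of_neg _ (Int.ediv_neg_of_neg_of_pos hk hp0)]
    · rfl
  · obtain ⟨m, rfl⟩ := Int.eq_ofNat_of_zero_le hk
    rw [coeffZ_natCast]
    split_ifs with h <;> rw [Int.natCast_dvd_natCast] at h
    · obtain ⟨i, rfl⟩ := h
      rw [coeff_expand_mul, Nat.cast_mul, Int.mul_ediv_cancel_left _ hp0.ne', coeffZ_natCast]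
    · exact coeff_expand_of_not_dvd _ _ _ h

variable {γ : ℂ_[p]}

/-- The coefficient of `t^k`, for `k < 0`, in `ζ(γ t) θ̂₁(t)`. -/
def polarCoeff (γ : ℂ_[p]) (k : ℤ) : ℂ_[p] :=
  if k < 0 then zetaPair γ (hatOne p γ * X ^ (-k - 1).toNat) else 0

theorem polarCoeff_neg_succ (γ : ℂ_[p]) (q : ℕ) :
    polarCoeff γ (-(q + 1 : ℤ)) = zetaPair γ (hatOne p γ * X ^ q) := by
  rw [polarCoeff, if_pos (by omega)]
  congr 3
  omega

theorem exists_eq_neg_succ {k : ℤ} (hk : k < 0) : ∃ q : ℕ, k = -(q + 1 : ℤ) :=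
  ⟨(-k - 1).toNat, by omega⟩

theorem hasSum_zetaCoeff_mul (hγ : ‖γ‖ ^ (p - 1) = (p : ℝ)⁻¹)
    (hs : HasSum (fun i : ℕ => γ ^ (p ^ i) / (p : ℂ_[p]) ^ i) 0) {k : ℤ} (hk : k < 0) :
    HasSum (fun x => zetaCoeff p x * γ ^ x * coeffZ (hatOne p γ) (k - x)) (polarCoeff γ k) := by
  have hγ0 := gamma_ne_zero p hγ
  obtain ⟨q, rfl⟩ := exists_eq_neg_succ hk
  have h1 := (summable_neg_one_pow_mul ((wtNull_hatOne p hγ hs).mul hγ0 (wtNull_X_pow q))).hasSum.mul_left γ⁻¹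
  have hinj : Function.Injective fun l : ℕ => -(l + 1 : ℤ) := fun x y h => by
    simpa using h
  rw [polarCoeff_neg_succ, zetaPair]
  refine (hinj.hasSum_iff fun x hx => ?_).1 ?_
  · have : ¬ x < 0 := fun h => hx <| by
      obtain ⟨l, rfl⟩ := exists_eq_neg_succ h
      exact ⟨l, rfl⟩
    rw [zetaCoeff, if_neg this, zero_mul, zero_mul]
  · have h2 (l : ℕ) : zetaCoeff p (-(l + 1 : ℤ)) * γ ^ (-(l + 1 : ℤ)) *
        coeffZ (hatOne p γ) (-(q + 1 : ℤ) - -(l + 1 : ℤ)) =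
          γ⁻¹ * ((-1) ^ l * wt γ (hatOne p γ * X ^ q) l) := by
      have e1 : (-(-(l + 1 : ℤ)) - 1).toNat = l := by omega
      have e2 : -(q + 1 : ℤ) - -(l + 1 : ℤ) = (l : ℤ) - q := by ring
      have e3 : γ ^ (-(l + 1 : ℤ)) = γ⁻¹ / γ ^ l := by
        rw [zpow_neg, zpow_add₀ hγ0, zpow_one, zpow_natCast, mul_inv, mul_comm, div_eq_mul_inv]
      rw [zetaCoeff, if_pos (by omega), e1, e2, e3, coeffZ_sub_natCast, wt]
      ring
    simp only [Function.comp_def, h2]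
    exact h1

theorem hasSum_dworkTheta_mul_polarCoeff (hγ : ‖γ‖ ^ (p - 1) = (p : ℝ)⁻¹)
    (hs : HasSum (fun i : ℕ => γ ^ (p ^ i) / (p : ℂ_[p]) ^ i) 0) {k : ℤ} (hk : k < 0) :
    HasSum (fun x => coeffZ (dworkTheta p γ) x *
      if (p : ℤ) ∣ k - x then polarCoeff γ ((k - x) / p) else 0) (p * polarCoeff γ k) := by
  have hp0 : (0 : ℤ) < p := by exact_mod_cast hp.1.pos
  have hcast : ((p - 1 : ℕ) : ℤ) = p - 1 := by
    rw [Nat.cast_sub hp.1.one_lt.le, Nat.cast_one]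
  obtain ⟨q, rfl⟩ := exists_eq_neg_succ hk
  have hinj : Function.Injective fun m : ℕ => ((p * m + (p - 1) : ℕ) : ℤ) - q := fun x y h => by
    have h1 : p * x + (p - 1) = p * y + (p - 1) := by exact_mod_cast sub_left_injective h
    exact Nat.eq_of_mul_eq_mul_left hp.1.pos (Nat.add_right_cancel h1)
  rw [polarCoeff_neg_succ]
  refine (hinj.hasSum_iff fun x hx => ?_).1 ?_
  · split_ifs with hd
    · obtain ⟨l, hl⟩ := hd
      have : ¬ l < 0 := fun h => hx <| by
        obtain ⟨m, rfl⟩ := exists_eq_neg_succ h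
        refine ⟨m, ?_⟩
        dsimp only
        rw [Nat.cast_add, Nat.cast_mul, hcast]
        linear_combination hl
      rw [hl, Int.mul_ediv_cancel_left _ hp0.ne', polarCoeff, if_neg this, mul_zero]
    · rw [mul_zero]
  · convert hasSum_coeff_sectionOp_mul_zetaPair p hγ hs q using 2 with m
    have e1 : -(q + 1 : ℤ) - (((p * m + (p - 1) : ℕ) : ℤ) - q) = p * (-(m + 1 : ℤ)) := by
      rw [Nat.cast_add, Nat.cast_mul, hcast]
      ring
    simp only [Function.comp_apply]
    rw [e1, if_pos (dvd_mul_right _ _), Int.mul_ediv_cancel_left _ hp0.ne', coeffZ_sub_natCast,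
      polarCoeff_neg_succ, coeff_sectionOp]

theorem norm_polarCoeff_le (hγ : ‖γ‖ ^ (p - 1) = (p : ℝ)⁻¹)
    (hs : HasSum (fun i : ℕ => γ ^ (p ^ i) / (p : ℂ_[p]) ^ i) 0) {k : ℤ} (hk : k < 0) :
    ‖polarCoeff γ k‖ ≤ ‖γ‖ ^ k * ‖((-k - 1).toNat.factorial : ℂ_[p])‖ := by
  obtain ⟨q, rfl⟩ := exists_eq_neg_succ hk
  have e1 : (-(-(q + 1 : ℤ)) - 1).toNat = q := by omega
  rw [polarCoeff_neg_succ, e1, zpow_neg, inv_mul_eq_div]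
  exact_mod_cast norm_zetaPair_mul_X_pow_le (gamma_ne_zero p hγ)
    (fun m => (norm_wt_hatOne_le p hγ hs m).trans
      (pow_le_one₀ (rad_pos p).le (rad_lt_one p).le)) q

theorem polarCoeff_neg_one_ne_zero (hγ : ‖γ‖ ^ (p - 1) = (p : ℝ)⁻¹)
    (hs : HasSum (fun i : ℕ => γ ^ (p ^ i) / (p : ℂ_[p]) ^ i) 0) : polarCoeff γ (-1) ≠ 0 := by
  have h := polarCoeff_neg_succ γ 0
  rw [pow_zero, mul_one, Nat.cast_zero, zero_add] at h
  rw [h]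
  refine zetaPair_ne_zero (gamma_ne_zero p hγ) (rad_lt_one p) (coeff_zero_expLac p _)
    (fun m => (norm_wt_hatOne_le p hγ hs (m + 1)).trans ?_) (wtNull_hatOne p hγ hs)
  rw [pow_succ]
  exact mul_le_of_le_one_left (rad_pos p).le (pow_le_one₀ (rad_pos p).le (rad_lt_one p).le)

theorem norm_coeff_expLac_gamSum_le (hγ : ‖γ‖ ^ (p - 1) = (p : ℝ)⁻¹)
    (hs : HasSum (fun i : ℕ => γ ^ (p ^ i) / (p : ℂ_[p]) ^ i) 0) (m : ℕ) :
    ‖coeff m (expLac p (gamSum p γ))‖ ≤ ‖γ‖ ^ m / ‖(m.factorial : ℂ_[p])‖ := by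
  have hγ0 := gamma_ne_zero p hγ
  have h1 : ‖wt γ (expLac p (gamSum p γ)) m‖ ≤ 1 := by
    rw [← exp_mul_hatOne]
    refine norm_wt_mul_le_one hγ0 (fun i => ?_) (fun i => (norm_wt_hatOne_le p hγ hs i).trans
      (pow_le_one₀ (rad_pos p).le (rad_lt_one p).le)) m
    have h0 : (i.factorial : ℂ_[p]) ≠ 0 := Nat.cast_ne_zero.2 (Nat.factorial_ne_zero _)
    have : wt γ (rescale γ (PowerSeries.exp ℂ_[p])) i = 1 := by
      rw [wt, coeff_rescale, coeff_exp]
      simp only [map_div₀, map_one, map_natCast]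
      have := gamma_ne_zero p hγ
      field_simp
    rw [this, norm_one]
  rw [coeff_eq_wt hγ0, norm_div, norm_mul, norm_pow]
  exact div_le_div_of_nonneg_right (mul_le_of_le_one_left (by positivity) h1) (norm_nonneg _)

end OneVariable

section Degrees

variable (a : Fin N → Fin (n + 1) → ℕ)

theorem deg_castSucc (ν : Fin N → ℤ) (i : Fin (n + 1)) :
    deg a ν i.castSucc = ∑ j, ν j * a j i := by
  simp [deg, aPlus]

theorem deg_last (ν : Fin N → ℤ) : deg a ν (Fin.last (n + 1)) = ∑ j, ν j := by
  simp [deg, aPlus]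

theorem aPlus_nonneg (j : Fin N) (i : Fin (n + 2)) : 0 ≤ aPlus a j i := by
  refine Fin.lastCases ?_ (fun i => ?_) i <;> simp [aPlus]

theorem deg_nonneg {ν : Fin N → ℤ} (h : ∀ j, 0 ≤ ν j) (i : Fin (n + 2)) : 0 ≤ deg a ν i := by
  rw [deg, Finset.sum_apply]
  exact Finset.sum_nonneg fun j _ => mul_nonneg (h j) (aPlus_nonneg a j i)

theorem deg_sub (ν κ : Fin N → ℤ) : deg a (ν - κ) = deg a ν - deg a κ := by
  simp [deg, sub_smul]

theorem deg_mul_left (c : ℤ) (ν : Fin N → ℤ) (i : Fin (n + 2)) :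
    deg a (fun j => c * ν j) i = c * deg a ν i := by
  simp only [deg, Finset.sum_apply, Pi.smul_apply, smul_eq_mul, Finset.mul_sum, mul_assoc]

theorem deg_mem_closure (ν : Fin N → ℤ) :
    deg a ν ∈ AddSubgroup.closure (Set.range (aPlus a)) :=
  AddSubgroup.sum_mem _ fun j _ =>
    AddSubgroup.zsmul_mem _ (AddSubgroup.subset_closure (Set.mem_range_self j)) _

variable {a} {d μ : ℕ}

theorem exists_unique_support
    (hsum : ∀ i, ∑ j ∈ Finset.univ.filter (fun j : Fin N => (j : ℕ) < μ + 1), a j i = 1)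
    (i : Fin (n + 1)) : ∃ j₀ : Fin N, (j₀ : ℕ) < μ + 1 ∧ a j₀ i = 1 ∧
    ∀ j : Fin N, (j : ℕ) < μ + 1 → j ≠ j₀ → a j i = 0 := by
  have h := hsum i
  have hne : ∃ j ∈ Finset.univ.filter (fun j : Fin N => (j : ℕ) < μ + 1), a j i ≠ 0 := by
    by_contra hh
    push Not at hh
    rw [Finset.sum_eq_zero hh] at h
    exact zero_ne_one h
  obtain ⟨j₀, hj₀, h0⟩ := hne
  have h1 := Finset.add_sum_erase _ (fun j => a j i) hj₀
  rw [h] at h1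
  refine ⟨j₀, (Finset.mem_filter.1 hj₀).2, by omega, fun j hj hne => ?_⟩
  have h2 : ∑ x ∈ (Finset.univ.filter (fun j : Fin N => (j : ℕ) < μ + 1)).erase j₀, a x i = 0 := by
    omega
  exact Finset.sum_eq_zero_iff.1 h2 j
    (Finset.mem_erase.2 ⟨hne, Finset.mem_filter.2 ⟨Finset.mem_univ _, hj⟩⟩)

/-- The part of `ν` at the places `j > μ`, as natural numbers. -/
def natPart (μ : ℕ) (ν : Fin N → ℤ) (j : Fin N) : ℕ :=
  if (j : ℕ) < μ + 1 then 0 else (ν j).toNat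

theorem add_sum_natPart_lt {ν : Fin N → ℤ} (hdeg : ∀ i, deg a ν i < 0)
    (hν : ∀ j : Fin N, μ + 1 ≤ (j : ℕ) → 0 ≤ ν j) {i : Fin (n + 1)} {j₀ : Fin N}
    (hj₀ : (j₀ : ℕ) < μ + 1) (h1 : a j₀ i = 1)
    (h0 : ∀ j : Fin N, (j : ℕ) < μ + 1 → j ≠ j₀ → a j i = 0) :
    ν j₀ + ((∑ j, natPart μ ν j * a j i : ℕ) : ℤ) < 0 := by
  have h := hdeg i.castSucc
  rw [deg_castSucc] at h
  have h2 : ∑ j, (ν j * a j i - ((natPart μ ν j * a j i : ℕ) : ℤ)) = ν j₀ := by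
    rw [Finset.sum_eq_single j₀]
    · simp [natPart, hj₀, h1]
    · intro j _ hne
      by_cases hj : (j : ℕ) < μ + 1
      · simp [h0 j hj hne]
      · simp [natPart, hj, hν j (not_lt.1 hj)]
    · exact fun hh => absurd (Finset.mem_univ _) hh
  rw [Finset.sum_sub_distrib] at h2
  rw [Nat.cast_sum]
  linarith

theorem neg_of_deg_neg
    (hsum : ∀ i, ∑ j ∈ Finset.univ.filter (fun j : Fin N => (j : ℕ) < μ + 1), a j i = 1)
    (hd : d ≠ 0) (ha : ∀ j, ∑ i, a j i = d) {ν : Fin N → ℤ}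
    (hdeg : ∀ i, deg a ν i < 0) (hν : ∀ j : Fin N, μ + 1 ≤ (j : ℕ) → 0 ≤ ν j) (j : Fin N)
    (hj : (j : ℕ) < μ + 1) : ν j < 0 := by
  obtain ⟨i, hi⟩ : ∃ i, a j i ≠ 0 := by
    by_contra hh
    push Not at hh
    have := ha j
    rw [Finset.sum_eq_zero fun i _ => hh i] at this
    exact hd this.symm
  obtain ⟨j₀, hj₀, h1, h0⟩ := exists_unique_support hsum i
  have hjj : j = j₀ := by
    by_contra hne
    exact hi (h0 j hj hne)
  subst hjj
  have := add_sum_natPart_lt hdeg hν hj₀ h1 h0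
  omega

theorem prod_factorial_dvd
    (hsum : ∀ i, ∑ j ∈ Finset.univ.filter (fun j : Fin N => (j : ℕ) < μ + 1), a j i = 1)
    (hd : d ≠ 0) (ha : ∀ j, ∑ i, a j i = d) {ν : Fin N → ℤ}
    (hdeg : ∀ i, deg a ν i < 0) (hν : ∀ j : Fin N, μ + 1 ≤ (j : ℕ) → 0 ≤ ν j) :
    ∏ j, (natPart μ ν j).factorial ∣
      ∏ j : Fin N, if (j : ℕ) < μ + 1 then (-ν j - 1).toNat.factorial else 1 := by
  set A : Fin N → ℕ := fun j => if (j : ℕ) < μ + 1 then (-ν j - 1).toNat.factorial else 1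
  have hpow (f : Fin N → ℕ) : (∏ j, f j) ^ d = ∏ i, ∏ j, f j ^ a j i := by
    rw [Finset.prod_comm, ← Finset.prod_pow]
    exact Finset.prod_congr rfl fun j _ => by rw [Finset.prod_pow_eq_pow_sum, ha j]
  rw [← Nat.pow_dvd_pow_iff hd, hpow, hpow]
  refine Finset.prod_dvd_prod_of_dvd _ _ fun i _ => ?_
  obtain ⟨j₀, hj₀, h1, h0⟩ := exists_unique_support hsum i
  have hlt := add_sum_natPart_lt hdeg hν hj₀ h1 h0
  have hA : ∏ j, A j ^ a j i = (-ν j₀ - 1).toNat.factorial := by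
    rw [Finset.prod_eq_single j₀]
    · rw [h1, pow_one]
      exact if_pos hj₀
    · intro j _ hne
      by_cases hj : (j : ℕ) < μ + 1
      · rw [h0 j hj hne, pow_zero]
      · rw [show A j = 1 from if_neg hj, one_pow]
    · exact fun hh => absurd (Finset.mem_univ _) hh
  have hfac (m k : ℕ) : m.factorial ^ k ∣ (m * k).factorial := by
    have := Nat.prod_factorial_dvd_factorial_sum (Finset.range k) fun _ => m
    simpa [mul_comm] using this
  rw [hA]
  refine (Finset.prod_dvd_prod_of_dvd _ _ fun j _ => hfac (natPart μ ν j) (a j i)).trans ?_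
  refine (Nat.prod_factorial_dvd_factorial_sum _ _).trans (Nat.factorial_dvd_factorial ?_)
  omega

end Degrees

section Products

variable {a : Fin N → Fin (n + 1) → ℕ}

theorem prodSubst_of_ne {c : Fin N → ℤ → ℂ_[p]} {m : (Fin (n + 2) → ℤ) × (Fin N → ℤ)}
    (h : m.1 ≠ deg a m.2) : prodSubst a c m = 0 :=
  if_neg h

theorem hasSum_mulTerm_prodSubst {c c' : Fin N → ℤ → ℂ_[p]} {G : Fin N → ℂ_[p]} {ν : Fin N → ℤ}
    (h : ∀ j, HasSum (fun k => c j k * c' j (ν j - k)) (G j)) :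
    HasSum (mulTerm (prodSubst a c) (prodSubst a c') (deg a ν, ν)) (∏ j, G j) := by
  have hinj : Function.Injective fun κ : Fin N → ℤ => (deg a κ, κ) :=
    fun x y hxy => (Prod.ext_iff.1 hxy).2
  refine (hinj.hasSum_iff fun q hq => ?_).1 ?_
  · have : q.1 ≠ deg a q.2 := fun hh => hq ⟨q.2, Prod.ext hh.symm rfl⟩
    rw [mulTerm, prodSubst_of_ne this, zero_mul]
  · have h2 (κ : Fin N → ℤ) : mulTerm (prodSubst a c) (prodSubst a c') (deg a ν, ν) (deg a κ, κ) =
        ∏ j, c j (κ j) * c' j (ν j - κ j) := by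
      rw [mulTerm, prodSubst, if_pos rfl, Prod.mk_sub_mk, prodSubst, if_pos (deg_sub a ν κ).symm,
        ← Finset.prod_mul_distrib]
      rfl
    simp only [Function.comp_def, h2]
    exact hasSum_prod_fin N (fun j k => c j k * c' j (ν j - k)) G h

theorem prodSubst_eq_zero {c : Fin N → ℤ → ℂ_[p]} {m : (Fin (n + 2) → ℤ) × (Fin N → ℤ)} (j : Fin N)
    (h : c j (m.2 j) = 0) : prodSubst a c m = 0 := by
  rw [prodSubst, Finset.prod_eq_zero (Finset.mem_univ j) h, ite_self]

theorem nonneg_of_prodSubst_ne_zero {c : Fin N → ℤ → ℂ_[p]} (hc : ∀ j k, k < 0 → c j k = 0)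
    {m : (Fin (n + 2) → ℤ) × (Fin N → ℤ)} (h : prodSubst a c m ≠ 0) (i : Fin (n + 2)) :
    0 ≤ m.1 i := by
  have h1 : m.1 = deg a m.2 := by
    by_contra hh
    exact h (if_neg hh)
  rw [h1]
  refine deg_nonneg a (fun j => ?_) i
  by_contra hh
  exact h (prodSubst_eq_zero j (hc j _ (not_le.1 hh)))

theorem mulTerm_deltaMinus_left (f : Series p n N) {c : Fin N → ℤ → ℂ_[p]}
    (hc : ∀ j k, k < 0 → c j k = 0) {m : (Fin (n + 2) → ℤ) × (Fin N → ℤ)} (hm : ∀ i, m.1 i < 0) :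
    mulTerm (deltaMinus f) (prodSubst a c) m = mulTerm f (prodSubst a c) m := by
  funext q
  by_cases h : prodSubst a c (m - q) = 0
  · rw [mulTerm, mulTerm, h, mul_zero, mul_zero]
  · have hq (i : Fin (n + 2)) : q.1 i < 0 := by
      have h1 := nonneg_of_prodSubst_ne_zero hc h i
      have h2 := hm i
      rw [Prod.fst_sub, Pi.sub_apply] at h1
      omega
    rw [mulTerm, mulTerm, deltaMinus, if_pos hq]

theorem powSubst_deltaMinus_prodSubst {c : Fin N → ℤ → ℂ_[p]}
    {m : (Fin (n + 2) → ℤ) × (Fin N → ℤ)} (hm : ∀ i, m.1 i < 0) :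
    powSubst (deltaMinus (prodSubst a c)) m =
      prodSubst a (fun j k => if (p : ℤ) ∣ k then c j (k / p) else 0) m := by
  have hp0 : (0 : ℤ) < p := by exact_mod_cast hp.1.pos
  rw [powSubst]
  by_cases h2 : ∀ j, (p : ℤ) ∣ m.2 j
  · choose κ hκ using h2
    have hm2 : m.2 = fun j => (p : ℤ) * κ j := funext hκ
    have hdiv : (fun j => m.2 j / (p : ℤ)) = κ := by
      funext j
      rw [hκ, Int.mul_ediv_cancel_left _ hp0.ne']
    have hprod : ∏ j, (if (p : ℤ) ∣ m.2 j then c j (m.2 j / p) else 0) = ∏ j, c j (κ j) :=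
      Finset.prod_congr rfl fun j _ => by
        rw [if_pos ⟨κ j, hκ j⟩, hκ, Int.mul_ediv_cancel_left _ hp0.ne']
    by_cases h1 : m.1 = deg a m.2
    · have h3 (i : Fin (n + 2)) : m.1 i = p * deg a κ i := by
        rw [h1, hm2, deg_mul_left]
      have h4 : (fun i => m.1 i / (p : ℤ)) = deg a κ := by
        funext i
        rw [h3, Int.mul_ediv_cancel_left _ hp0.ne']
      have h5 (i : Fin (n + 2)) : deg a κ i < 0 := by
        have := hm i
        rw [h3] at this
        exact neg_of_mul_neg_right this hp0.le
      rw [if_pos ⟨fun i => ⟨_, h3 i⟩, fun j => ⟨_, hκ j⟩⟩, hdiv, h4, deltaMinus, if_pos h5, prodSubst,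
        if_pos rfl, prodSubst, if_pos h1, hprod]
    · rw [prodSubst, if_neg h1]
      split_ifs with hd
      · rw [deltaMinus, hdiv]
        split_ifs
        · refine if_neg fun h4 => h1 ?_
          funext i
          have h5 := congrFun h4 i
          dsimp only at h5
          rw [hm2, deg_mul_left, ← h5, Int.mul_ediv_cancel' (hd.1 i)]
        · rfl
      · rfl
  · rw [if_neg fun h => h2 h.2]
    push Not at h2
    obtain ⟨j, hj⟩ := h2
    exact (prodSubst_eq_zero j (if_neg hj)).symm

theorem mulTerm_powSubst_deltaMinus {c c' : Fin N → ℤ → ℂ_[p]}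
    (hc : ∀ j k, k < 0 → c j k = 0) {m : (Fin (n + 2) → ℤ) × (Fin N → ℤ)} (hm : ∀ i, m.1 i < 0) :
    mulTerm (prodSubst a c) (powSubst (deltaMinus (prodSubst a c'))) m =
      mulTerm (prodSubst a c)
        (prodSubst a fun j k => if (p : ℤ) ∣ k then c' j (k / p) else 0) m := by
  funext q
  by_cases h : prodSubst a c q = 0
  · rw [mulTerm, mulTerm, h, zero_mul, zero_mul]
  · have hq (i : Fin (n + 2)) : (m - q).1 i < 0 := by
      have h1 := nonneg_of_prodSubst_ne_zero hc h i
      have h2 := hm i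
      rw [Prod.fst_sub, Pi.sub_apply]
      omega
    rw [mulTerm, mulTerm, powSubst_deltaMinus_prodSubst hq]

theorem hasSum_mulTerm_of_deg_neg {d μ : ℕ} (hd : d ≠ 0) (ha : ∀ j, ∑ i, a j i = d)
    (hsum : ∀ i, ∑ j ∈ Finset.univ.filter (fun j : Fin N => (j : ℕ) < μ + 1), a j i = 1)
    {c c' G : Fin N → ℤ → ℂ_[p]}
    (h1 : ∀ j : Fin N, (j : ℕ) < μ + 1 → ∀ k < 0, HasSum (fun x => c j x * c' j (k - x)) (G j k))
    (h2 : ∀ j : Fin N, μ + 1 ≤ (j : ℕ) → ∀ k, HasSum (fun x => c j x * c' j (k - x)) (G j k))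
    (h3 : ∀ j : Fin N, μ + 1 ≤ (j : ℕ) → ∀ k < 0, c j k = 0 ∧ c' j k = 0 ∧ G j k = 0)
    {m : (Fin (n + 2) → ℤ) × (Fin N → ℤ)} (hm : ∀ i, m.1 i < 0) :
    HasSum (mulTerm (prodSubst a c) (prodSubst a c') m) (prodSubst a G m) := by
  obtain ⟨u, ν⟩ := m
  by_cases hu : u = deg a ν
  · subst hu
    by_cases hν : ∀ j : Fin N, μ + 1 ≤ (j : ℕ) → 0 ≤ ν j
    · have hneg := neg_of_deg_neg hsum hd ha hm hν
      rw [prodSubst, if_pos rfl]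
      refine hasSum_mulTerm_prodSubst fun j => ?_
      rcases lt_or_ge (j : ℕ) (μ + 1) with hj | hj
      · exact h1 j hj _ (hneg j hj)
      · exact h2 j hj _
    · push Not at hν
      obtain ⟨j, hj, hneg⟩ := hν
      rw [prodSubst_eq_zero j (h3 j hj _ hneg).2.2]
      have hz : mulTerm (prodSubst a c) (prodSubst a c') (deg a ν, ν) = fun _ => 0 := by
        funext q
        rw [mulTerm]
        rcases lt_or_ge (q.2 j) 0 with hq | hq
        · rw [prodSubst_eq_zero j (h3 j hj _ hq).1, zero_mul]
        · rw [prodSubst_eq_zero (m := (deg a ν, ν) - q) j (h3 j hj _ ?_).2.1, mul_zero]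
          change ν j - q.2 j < 0
          omega
      rw [hz]
      exact hasSum_zero
  · rw [prodSubst, if_neg hu]
    have hz : mulTerm (prodSubst a c) (prodSubst a c') (u, ν) = fun _ => 0 := by
      funext q
      rw [mulTerm]
      by_cases hq : q.1 = deg a q.2
      · have : ((u, ν) - q).1 ≠ deg a ((u, ν) - q).2 := fun hh => hu <| by
          rw [Prod.fst_sub, Prod.snd_sub, deg_sub, hq] at hh
          exact sub_left_injective hh
        rw [prodSubst_of_ne this, mul_zero]
      · rw [prodSubst_of_ne hq, zero_mul]
    rw [hz]
    exact hasSum_zero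

end Products

/-- The one-variable coefficients whose products are the coefficients of `G(Λ, x)`. -/
def factorCoeff (μ : ℕ) (γ : ℂ_[p]) (j : Fin N) (k : ℤ) : ℂ_[p] :=
  if (j : ℕ) < μ + 1 then polarCoeff γ k else coeffZ (expLac p (gamSum p γ)) k

variable {a : Fin N → Fin (n + 1) → ℕ} {d μ : ℕ} {γ : ℂ_[p]}

theorem hasSum_FSeries_mul (hd : d ≠ 0) (ha : ∀ j, ∑ i, a j i = d)
    (hsum : ∀ i, ∑ j ∈ Finset.univ.filter (fun j : Fin N => (j : ℕ) < μ + 1), a j i = 1)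
    (hγ : ‖γ‖ ^ (p - 1) = (p : ℝ)⁻¹)
    (hs : HasSum (fun i : ℕ => γ ^ (p ^ i) / (p : ℂ_[p]) ^ i) 0)
    {m : (Fin (n + 2) → ℤ) × (Fin N → ℤ)} (hm : ∀ i, m.1 i < 0) :
    HasSum (mulTerm (FSeries a μ γ) (thetaHatOneSeries a γ) m)
      (prodSubst a (factorCoeff μ γ) m) := by
  rw [FSeries, thetaHatOneSeries, mulTerm_deltaMinus_left _ (fun _ _ => coeffZ_of_neg _) hm]
  refine hasSum_mulTerm_of_deg_neg hd ha hsum (fun j hj k hk => ?_) (fun j hj k => ?_)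
    (fun j hj k hk => ⟨?_, coeffZ_of_neg _ hk, ?_⟩) hm
  · simp only [factorCoeff, if_pos hj]
    exact hasSum_zetaCoeff_mul hγ hs hk
  · simp only [factorCoeff, if_neg (not_lt.2 hj)]
    rw [← exp_mul_hatOne]
    exact hasSum_coeffZ_mul _ _ k
  · rw [if_neg (not_lt.2 hj), coeffZ_of_neg _ hk]
  · rw [factorCoeff, if_neg (not_lt.2 hj), coeffZ_of_neg _ hk]

theorem GSeries_eq (hd : d ≠ 0) (ha : ∀ j, ∑ i, a j i = d)
    (hsum : ∀ i, ∑ j ∈ Finset.univ.filter (fun j : Fin N => (j : ℕ) < μ + 1), a j i = 1)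
    (hγ : ‖γ‖ ^ (p - 1) = (p : ℝ)⁻¹)
    (hs : HasSum (fun i : ℕ => γ ^ (p ^ i) / (p : ℂ_[p]) ^ i) 0) :
    GSeries a μ γ = deltaMinus (prodSubst a (factorCoeff μ γ)) := by
  funext m
  rw [GSeries, deltaMinus, deltaMinus]
  split_ifs with hm
  · exact (hasSum_FSeries_mul hd ha hsum hγ hs hm).tsum_eq
  · rfl

theorem hasSum_thetaSeries_mul (hd : d ≠ 0) (ha : ∀ j, ∑ i, a j i = d)
    (hsum : ∀ i, ∑ j ∈ Finset.univ.filter (fun j : Fin N => (j : ℕ) < μ + 1), a j i = 1)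
    (hγ : ‖γ‖ ^ (p - 1) = (p : ℝ)⁻¹)
    (hs : HasSum (fun i : ℕ => γ ^ (p ^ i) / (p : ℂ_[p]) ^ i) 0) (hN : μ + 1 ≤ N)
    {m : (Fin (n + 2) → ℤ) × (Fin N → ℤ)} (hm : ∀ i, m.1 i < 0) :
    HasSum (mulTerm (thetaSeries a γ) (powSubst (GSeries a μ γ)) m)
      ((p : ℂ_[p]) ^ (μ + 1) * prodSubst a (factorCoeff μ γ) m) := by
  have hprod : (p : ℂ_[p]) ^ (μ + 1) * prodSubst a (factorCoeff μ γ) m =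
      prodSubst a (fun j k => (if (j : ℕ) < μ + 1 then (p : ℂ_[p]) else 1) * factorCoeff μ γ j k)
        m := by
    rw [prodSubst, prodSubst, mul_ite, mul_zero, Finset.prod_mul_distrib, Finset.prod_ite,
      Finset.prod_const, Finset.prod_const_one, mul_one, Fin.card_filter_val_lt, min_eq_right hN]
  have hp0 : (0 : ℤ) < p := by exact_mod_cast hp.1.pos
  rw [GSeries_eq hd ha hsum hγ hs, hprod, thetaSeries,
    mulTerm_powSubst_deltaMinus (fun _ _ => coeffZ_of_neg _) hm]
  refine hasSum_mulTerm_of_deg_neg hd ha hsum (fun j hj k hk => ?_) (fun j hj k => ?_)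
    (fun j hj k hk => ⟨coeffZ_of_neg _ hk, ?_, ?_⟩) hm
  · simp only [factorCoeff, if_pos hj]
    exact hasSum_dworkTheta_mul_polarCoeff hγ hs hk
  · simp only [factorCoeff, if_neg (not_lt.2 hj), one_mul, ← coeffZ_expand]
    have h := hasSum_coeffZ_mul (dworkTheta p γ)
      (expand p hp.1.ne_zero (expLac p (gamSum p γ))) k
    rw [dworkTheta_mul_expand] at h
    exact h
  · simp only [factorCoeff, if_neg (not_lt.2 hj), ← coeffZ_expand]
    exact coeffZ_of_neg _ hk
  · simp only [factorCoeff, if_neg (not_lt.2 hj)]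
    rw [coeffZ_of_neg _ hk, mul_zero]

theorem norm_prod_factorCoeff_le (hd : d ≠ 0) (ha : ∀ j, ∑ i, a j i = d)
    (hsum : ∀ i, ∑ j ∈ Finset.univ.filter (fun j : Fin N => (j : ℕ) < μ + 1), a j i = 1)
    (hγ : ‖γ‖ ^ (p - 1) = (p : ℝ)⁻¹)
    (hs : HasSum (fun i : ℕ => γ ^ (p ^ i) / (p : ℂ_[p]) ^ i) 0) {ν : Fin N → ℤ}
    (hdeg : ∀ i, deg a ν i < 0) (hν : ∀ j : Fin N, μ + 1 ≤ (j : ℕ) → 0 ≤ ν j) :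
    ‖∏ j, factorCoeff μ γ j (ν j)‖ ≤ ‖γ‖ ^ (∑ j, ν j) := by
  have hneg := neg_of_deg_neg hsum hd ha hdeg hν
  have hg : 0 < ‖γ‖ := norm_pos_iff.2 (gamma_ne_zero p hγ)
  have hpos (k : ℕ) : 0 < ‖(k.factorial : ℂ_[p])‖ :=
    norm_pos_iff.2 (Nat.cast_ne_zero.2 k.factorial_ne_zero)
  set A : Fin N → ℕ := fun j => if (j : ℕ) < μ + 1 then (-ν j - 1).toNat.factorial else 1 with hA
  set B : Fin N → ℕ := fun j => (natPart μ ν j).factorial with hB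
  have hdvd : ∏ j, B j ∣ ∏ j, A j := prod_factorial_dvd hsum hd ha hdeg hν
  have hj (j : Fin N) : ‖factorCoeff μ γ j (ν j)‖ ≤
      ‖γ‖ ^ ν j * (‖(A j : ℂ_[p])‖ / ‖(B j : ℂ_[p])‖) := by
    rcases lt_or_ge (j : ℕ) (μ + 1) with hj | hj
    · simp only [factorCoeff, hA, hB, natPart, if_pos hj]
      rw [Nat.factorial_zero, Nat.cast_one, norm_one, div_one]
      exact norm_polarCoeff_le hγ hs (hneg j hj)
    · obtain ⟨k, hk⟩ := Int.eq_ofNat_of_zero_le (hν j hj)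
      simp only [factorCoeff, hA, hB, natPart, if_neg (not_lt.2 hj)]
      rw [hk, Nat.cast_one, norm_one, coeffZ_natCast, zpow_natCast, Int.toNat_natCast,
        mul_one_div]
      exact norm_coeff_expLac_gamSum_le hγ hs k
  have hzpow : ∏ j, ‖γ‖ ^ ν j = ‖γ‖ ^ (∑ j, ν j) := by
    induction (Finset.univ : Finset (Fin N)) using Finset.induction_on with
    | empty => simp
    | insert j s hjs ih => rw [Finset.prod_insert hjs, Finset.sum_insert hjs, ih, zpow_add₀ hg.ne']
  rw [norm_prod]
  refine (Finset.prod_le_prod (fun j _ => norm_nonneg _) fun j _ => hj j).trans ?_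
  rw [Finset.prod_mul_distrib, hzpow, Finset.prod_div_distrib, ← norm_prod, ← norm_prod,
    ← Nat.cast_prod, ← Nat.cast_prod]
  have hBpos : 0 < ‖((∏ j, B j : ℕ) : ℂ_[p])‖ :=
    norm_pos_iff.2 (Nat.cast_ne_zero.2 (Finset.prod_ne_zero_iff.2 fun j _ =>
      Nat.factorial_ne_zero _))
  exact mul_le_of_le_one_right (by positivity)
    ((div_le_one hBpos).2 (norm_natCast_le_of_dvd hdvd))

theorem norm_monomial_le_one {ν : Fin N → ℤ} (hν : ν ∈ expE N μ) {z : Fin N → ℂ_[p]}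
    (hz : z ∈ domD p N μ) : ‖∏ j, z j ^ ν j‖ ≤ 1 := by
  rw [norm_prod]
  refine Finset.prod_le_one (fun j _ => norm_nonneg _) fun j _ => ?_
  rw [norm_zpow]
  rcases lt_or_ge (j : ℕ) (μ + 1) with hj | hj
  · exact zpow_le_one_of_nonpos₀ ((hz j).1 hj).le ((hν j).1 hj)
  · obtain ⟨k, hk⟩ := Int.eq_ofNat_of_zero_le ((hν j).2 hj)
    rw [hk, zpow_natCast]
    exact pow_le_one₀ (norm_nonneg _) ((hz j).2 hj).le

theorem GSeries_mem_spaceS (hd : d ≠ 0) (ha : ∀ j, ∑ i, a j i = d)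
    (hsum : ∀ i, ∑ j ∈ Finset.univ.filter (fun j : Fin N => (j : ℕ) < μ + 1), a j i = 1)
    (hγ : ‖γ‖ ^ (p - 1) = (p : ℝ)⁻¹)
    (hs : HasSum (fun i : ℕ => γ ^ (p ^ i) / (p : ℂ_[p]) ^ i) 0) :
    GSeries a μ γ ∈ spaceS a μ γ := by
  have hg : 0 < ‖γ‖ := norm_pos_iff.2 (gamma_ne_zero p hγ)
  rw [GSeries_eq hd ha hsum hγ hs]
  set ξ : Series p n N := deltaMinus (prodSubst a (factorCoeff μ γ)) with hξ
  have hne {u : Fin (n + 2) → ℤ} {ν : Fin N → ℤ} (h : ξ (u, ν) ≠ 0) :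
      (∀ i, u i < 0) ∧ u = deg a ν ∧ (∀ j : Fin N, μ + 1 ≤ (j : ℕ) → 0 ≤ ν j) ∧
        ξ (u, ν) = ∏ j, factorCoeff μ γ j (ν j) := by
    have hu : ∀ i, u i < 0 := by
      by_contra hh
      exact h (if_neg hh)
    have h1 : ξ (u, ν) = prodSubst a (factorCoeff μ γ) (u, ν) := if_pos hu
    have hdeg : u = deg a ν := by
      by_contra hh
      exact h (h1.trans (prodSubst_of_ne hh))
    refine ⟨hu, hdeg, fun j hj => ?_, h1.trans (if_pos hdeg)⟩
    by_contra hh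
    refine h (h1.trans (prodSubst_eq_zero j ?_))
    rw [factorCoeff, if_neg (not_lt.2 hj), coeffZ_of_neg _ (not_le.1 hh)]
  have hbound (u : Fin (n + 2) → ℤ) (ν : Fin N → ℤ) : ‖coeffX γ ξ u ν‖ ≤ 1 := by
    rw [coeffX]
    by_cases h : ξ (u, ν) = 0
    · rw [h, mul_zero, norm_zero]
      exact zero_le_one
    · obtain ⟨hu, hdeg, hν, h1⟩ := hne h
      rw [norm_mul, norm_inv, norm_zpow, inv_mul_le_iff₀ (zpow_pos hg _), mul_one, h1, hdeg,
        deg_last]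
      exact norm_prod_factorCoeff_le hd ha hsum hγ hs (hdeg ▸ hu) hν
  have hsupp {u : Fin (n + 2) → ℤ} {ν : Fin N → ℤ} (h : coeffX γ ξ u ν ≠ 0) :
      ν ∈ expE N μ ∧ deg a ν = u := by
    obtain ⟨hu, hdeg, hν, -⟩ := hne (right_ne_zero_of_mul h)
    exact ⟨fun j => ⟨fun hj => (neg_of_deg_neg hsum hd ha (hdeg ▸ hu) hν j hj).le, hν j⟩, hdeg.symm⟩
  refine ⟨fun u ν h => ?_, fun u _ => ⟨fun ν => hsupp, 1, hbound u⟩, 1, fun u _ z hz => ?_⟩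
  · obtain ⟨hu, hdeg, -, -⟩ := hne h
    exact ⟨hdeg ▸ deg_mem_closure a ν, hu⟩
  · refine IsUltrametricDist.norm_tsum_le_of_forall_le_of_nonneg zero_le_one fun ν => ?_
    by_cases h : coeffX γ ξ u ν = 0
    · rw [h, zero_mul, norm_zero]
      exact zero_le_one
    · rw [norm_mul]
      exact mul_le_one₀ (hbound u ν) (norm_nonneg _) (norm_monomial_le_one (hsupp h).1 hz)

theorem GSeries_ne_zero (hd : d ≠ 0) (ha : ∀ j, ∑ i, a j i = d) (hN : μ + 1 ≤ N)
    (hsum : ∀ i, ∑ j ∈ Finset.univ.filter (fun j : Fin N => (j : ℕ) < μ + 1), a j i = 1)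
    (hγ : ‖γ‖ ^ (p - 1) = (p : ℝ)⁻¹)
    (hs : HasSum (fun i : ℕ => γ ^ (p ^ i) / (p : ℂ_[p]) ^ i) 0) :
    GSeries a μ γ ≠ 0 := by
  rw [GSeries_eq hd ha hsum hγ hs]
  let ν : Fin N → ℤ := fun j => if (j : ℕ) < μ + 1 then -1 else 0
  have hdeg (i : Fin (n + 2)) : deg a ν i < 0 := by
    refine Fin.lastCases ?_ (fun i => ?_) i
    · rw [deg_last]
      refine Finset.sum_neg' (fun j _ => ?_) ⟨⟨0, by omega⟩, Finset.mem_univ _, ?_⟩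
      · simp only [ν]
        split_ifs <;> omega
      · simp [ν]
    · have h1 : ∑ j, ν j * (a j i : ℤ) = -1 := by
        have h2 (j : Fin N) : ν j * (a j i : ℤ) =
            if (j : ℕ) < μ + 1 then -(a j i : ℤ) else 0 := by
          simp only [ν]
          split_ifs <;> ring
        rw [Finset.sum_congr rfl fun j _ => h2 j, ← Finset.sum_filter, Finset.sum_neg_distrib,
          ← Nat.cast_sum, hsum i, Nat.cast_one]
      rw [deg_castSucc, h1]
      norm_num
  intro h
  have h1 : deltaMinus (prodSubst a (factorCoeff μ γ)) (deg a ν, ν) =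
      ∏ j, factorCoeff μ γ j (ν j) := by
    rw [deltaMinus, if_pos hdeg, prodSubst, if_pos rfl]
  rw [h] at h1
  refine Finset.prod_ne_zero_iff.2 (fun j _ => ?_) h1.symm
  simp only [factorCoeff, ν]
  split_ifs with hj
  · exact polarCoeff_neg_one_ne_zero hγ hs
  · have h0 := coeffZ_natCast (expLac p (gamSum p γ)) 0
    rw [Nat.cast_zero, coeff_zero_expLac] at h0
    rw [h0]
    exact one_ne_zero

theorem norm_pow_prime_sub_one (h : ‖γ‖ = (p : ℝ) ^ (-(1 : ℝ) / ((p : ℝ) - 1))) :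
    ‖γ‖ ^ (p - 1) = (p : ℝ)⁻¹ := by
  have h1 : (1 : ℝ) < p := by exact_mod_cast hp.1.one_lt
  rw [h, ← Real.rpow_natCast, ← Real.rpow_mul (by positivity), Nat.cast_sub hp.1.one_lt.le,
    Nat.cast_one, div_mul_cancel₀ _ (by linarith), Real.rpow_neg_one]

end GenCY

end

theorem theorem5p14 (p : ℕ) [Fact p.Prime] (n d N μ : ℕ) (hd : 2 ≤ d)
    (hn : n + 1 = d * (μ + 1)) (hN : μ + 1 ≤ N)
    (a : Fin N → Fin (n + 1) → ℕ) (ha : ∀ j, ∑ i, a j i = d)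
    (hsum : ∀ i, ∑ j ∈ Finset.univ.filter (fun j : Fin N => (j : ℕ) < μ + 1), a j i = 1)
    (γ₀ : ℂ_[p])
    (hγ₀ : HasSum (fun i : ℕ => γ₀ ^ (p ^ i) / (p : ℂ_[p]) ^ i) 0)
    (hγ₀_norm : ‖γ₀‖ = (p : ℝ) ^ (-(1 : ℝ) / ((p : ℝ) - 1))) :
    GenCY.DeltaMulConverges (GenCY.FSeries a μ γ₀) (GenCY.thetaHatOneSeries a γ₀) ∧
    GenCY.GSeries a μ γ₀ ∈ GenCY.spaceS a μ γ₀ ∧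
    GenCY.GSeries a μ γ₀ ≠ 0 ∧
    GenCY.DeltaMulConverges (GenCY.thetaSeries a γ₀)
      (GenCY.powSubst (GenCY.GSeries a μ γ₀)) ∧
    GenCY.alphaStar a γ₀ (GenCY.GSeries a μ γ₀) =
      (p : ℂ_[p]) ^ (μ + 1) • GenCY.GSeries a μ γ₀ := by
  have hγ := GenCY.norm_pow_prime_sub_one hγ₀_norm
  have hd0 : d ≠ 0 := by omega
  refine ⟨fun m hm => (GenCY.hasSum_FSeries_mul hd0 ha hsum hγ hγ₀ hm).summable,
    GenCY.GSeries_mem_spaceS hd0 ha hsum hγ hγ₀, GenCY.GSeries_ne_zero hd0 ha hN hsum hγ hγ₀,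
    fun m hm => (GenCY.hasSum_thetaSeries_mul hd0 ha hsum hγ hγ₀ hN hm).summable, ?_⟩
  funext m
  rw [Pi.smul_apply, GenCY.alphaStar, GenCY.deltaMinus]
  split_ifs with hm
  · refine (GenCY.hasSum_thetaSeries_mul hd0 ha hsum hγ hγ₀ hN hm).tsum_eq.trans ?_
    rw [GenCY.GSeries_eq hd0 ha hsum hγ hγ₀, GenCY.deltaMinus, if_pos hm, smul_eq_mul]
  · rw [GenCY.GSeries, GenCY.deltaMinus, if_neg hm, smul_zero]
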